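/- **Setting.** Let $d\ge 2$, let $p\in[2,\infty]$ with Hölder conjugate $q$ ($1/p+1/q=1$), and let $\mathcal D$ be a distribution of $(x,y)\in\mathbb R^d\times\{\pm1\}$ with marginal $\mathcal D_x$ such that $\|x\|_p\le 1$ almost surely. For $w\in\mathbb R^d$ and $r\ge 0$ let $$\mathrm{err}^{p,r}_{\mathcal D}(w)=\mathbb P_{(x,y)\sim\mathcal D}\big[\exists x':\ \|x'-x\|_p\le r,\ \mathrm{sgn}(\langle w,x'\rangle)\ne y\big]$$ (with $\mathrm{sgn}(0)=0$, so that a tie counts as an error) and $\mathsf{OPT}=\mathsf{OPT}_{p,r}=\min_{\|w\|_q=1}\mathrm{err}^{p,r}_{\mathcal D}(w)$. Suppose that $\mathcal D_x$ satisfies $U$-anti-concentration and $(U',R)$-anti-anti-concentration: for every pair of orthonormal vectors $v,v'$, the vector $(\langle v,x\rangle,\langle v',x\rangle)$, $x\sim\mathcal D_x$, has a density on $\mathbb R^2$ that is at most $U$ everywhere and at least $1/U'$ at all $z$ with $\|z\|_2\le R$. **Algorithm.** Adversarial training with the cross-entropy loss $\ell(z)=\log(1+e^{-z})$, step size $\eta$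 and an i.i.d. sample $(x_1,y_1),\dots,(x_n,y_n)$ from $\mathcal D$ starts from $w_0=0$ and iterates $$\delta_{k,i}\in\operatorname*{arg\,max}_{\|\delta\|_p\le r}\ell\big(y_i\langle w_k,x_i+\delta\rangle\big),\qquad w_{k+1}=w_k-\frac{\eta}{n}\sum_{i=1}^n\ell'\big(y_i\langle w_k,x_i+\delta_{k,i}\rangle\big)\,y_i\,(x_i+\delta_{k,i}).$$ **Claim.** For all $U,U',R>0$ there are constants $C>0$ and $m\in\mathbb N$, depending only on $U,U',R$, such that the following holds for all $d$, $p$, $\mathcal D$ as above and all $0\le r\le R$, $0<\delta<1$ and $0<\eta\le \mathsf{OPT}/(4H)$, where $H=4$ if $p\le 2$ and $H=4d$ if $p>2$. Write $\Lambda=\log(d/\mathsf{OPT})$. If $$n\ \ge\ C\,\log^m\!\Big(\frac{d}{\delta\,\mathsf{OPT}}\Big)\; d^{\,1-\frac2p}\,\mathsf{OPT}^{-2},$$ then with probability at least $1-\delta$ over the sample there is, in every run of adversarial training, an iterate $w_k$ with $$k\ \le\ C\,\Lambda^m\;\eta^{-1}\,d^{\,\frac{3}{2p}-\frac34}\,\mathsf{OPT}^{-3}$$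 and $$\mathrm{err}^{p,r}_{\mathcal D}(w_k)\ \le\ C\,\Lambda^m\Big(d^{\,\frac14-\frac1{2p}}\sqrt{\mathsf{OPT}_{p,r}}+d^{\,\frac12-\frac1p}\,\mathsf{OPT}_{p,r}\Big).$$ In particular, $\mathrm{err}^{2,r}_{\mathcal D}(w_k)\le C\,\Lambda^m\sqrt{\mathsf{OPT}_{2,r}}$ for $p=2$, and $\mathrm{err}^{\infty,r}_{\mathcal D}(w_k)\le C\,\Lambda^m\big(d^{1/4}\sqrt{\mathsf{OPT}_{\infty,r}}+d^{1/2}\,\mathsf{OPT}_{\infty,r}\big)$ for $p=\infty$. -/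

import Mathlib

open MeasureTheory
open scoped ENNReal

namespace AdvHalfspace

/-- The `ℓ_p` norm on `ℝ^d`, for `p ∈ [1, ∞]`. -/
noncomputable def vecNorm {d : ℕ} (p : ℝ≥0∞) (x : Fin d → ℝ) : ℝ :=
  ‖WithLp.toLp p x‖

/-- The robust classification error of the halfspace `x ↦ sgn ⟨w, x⟩` under `ℓ_p` perturbations of
radius `r`: the probability, over `(x, y) ∼ D`, that some `x'` with `‖x' - x‖_p ≤ r` is not given
the label `y ∈ {1, -1}`. As `Real.sign 0 = 0`, a tie `⟨w, x'⟩ = 0` counts as an error. -/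
noncomputable def robustError {d : ℕ} (D : Measure ((Fin d → ℝ) × ℝ)) (p : ℝ≥0∞) (r : ℝ)
    (w : Fin d → ℝ) : ℝ :=
  D.real {z | ∃ x' : Fin d → ℝ, vecNorm p (x' - z.1) ≤ r ∧ Real.sign (w ⬝ᵥ x') ≠ z.2}

/-- The best robust error of a halfspace: the minimum of the robust error (for `ℓ_p` perturbations
of radius `r`) over the unit sphere of the `ℓ_q` norm. -/
noncomputable def robustOpt {d : ℕ} (D : Measure ((Fin d → ℝ) × ℝ)) (p q : ℝ≥0∞) (r : ℝ) : ℝ :=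
  ⨅ w : {w : Fin d → ℝ // vecNorm q w = 1}, robustError D p r w

/-- `f` is a density, with respect to Lebesgue measure on `ℝ²`, of the marginal of `μ` on the plane
spanned by `v` and `v'`, in the coordinates given by the orthonormal vectors `v`, `v'`. -/
def IsMarginalDensity {d : ℕ} (μ : Measure (Fin d → ℝ)) (v v' : Fin d → ℝ) (f : ℝ × ℝ → ℝ≥0∞) :
    Prop :=
  Measurable f ∧ μ.map (fun x => (v ⬝ᵥ x, v' ⬝ᵥ x)) = volume.withDensity f

/-- `v`, `v'` is an orthonormal pair for the Euclidean inner product. -/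
def IsOrthonormalPair {d : ℕ} (v v' : Fin d → ℝ) : Prop :=
  v ⬝ᵥ v = 1 ∧ v' ⬝ᵥ v' = 1 ∧ v ⬝ᵥ v' = 0

/-- `U`-anti-concentration: every two-dimensional marginal of `μ` has a density that is at most
`U` everywhere. -/
def AntiConcentrated {d : ℕ} (μ : Measure (Fin d → ℝ)) (U : ℝ) : Prop :=
  ∀ v v' : Fin d → ℝ, IsOrthonormalPair v v' →
    ∃ f, IsMarginalDensity μ v v' f ∧ ∀ z, f z ≤ ENNReal.ofReal U

/-- `(U', R)`-anti-anti-concentration: every two-dimensional marginal of `μ` has a density that is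
at least `1 / U'` on the Euclidean ball of radius `R` about the origin. -/
def AntiAntiConcentrated {d : ℕ} (μ : Measure (Fin d → ℝ)) (U' R : ℝ) : Prop :=
  ∀ v v' : Fin d → ℝ, IsOrthonormalPair v v' →
    ∃ f, IsMarginalDensity μ v v' f ∧
      ∀ z : ℝ × ℝ, z.1 ^ 2 + z.2 ^ 2 ≤ R ^ 2 → ENNReal.ofReal (1 / U') ≤ f z

/-- The cross-entropy loss `ℓ(z) = log (1 + exp (-z))`. -/
noncomputable def crossEntropy (z : ℝ) : ℝ := Real.log (1 + Real.exp (-z))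

/-- `w 0, w 1, w 2, …` are the iterates of adversarial training on the sample `S` with the
cross-entropy loss and step size `η`. In step `k`, each `x_i` is perturbed by a maximizer `δ k i` of
`δ ↦ ℓ(y_i ⟨w k, x_i + δ⟩)` over the `ℓ_p` ball of radius `r` (any one, if there are several), and
then a gradient step is made in which the perturbed samples are treated as constants. -/
def IsAdversarialTraining {d n : ℕ} (p : ℝ≥0∞) (r η : ℝ) (S : Fin n → (Fin d → ℝ) × ℝ)
    (w : ℕ → Fin d → ℝ) : Prop :=
  ∃ δ : ℕ → Fin n → Fin d → ℝ,
    (∀ k i, vecNorm p (δ k i) ≤ r ∧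
      ∀ δ' : Fin d → ℝ, vecNorm p δ' ≤ r →
        crossEntropy ((S i).2 * (w k ⬝ᵥ ((S i).1 + δ'))) ≤
          crossEntropy ((S i).2 * (w k ⬝ᵥ ((S i).1 + δ k i)))) ∧
    ∀ k, w (k + 1) = w k - (η / n) • ∑ i,
      (deriv crossEntropy ((S i).2 * (w k ⬝ᵥ ((S i).1 + δ k i))) * (S i).2) •
        ((S i).1 + δ k i)

end AdvHalfspace

open AdvHalfspace

/-
Let `o` be the optimal robust error, `B = d ^ (1 / 2 - 1 / p)` the largest ratio of `‖x‖_2` to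
`‖x‖_p`, and `ε = √(B * o)`; if `ε` is not small there is nothing to prove. Gradient descent is
compared with `ε⁻¹ • v`, for a Euclidean unit vector `v` whose direction is nearly optimal: by
anti-concentration of `⟨v, x⟩` its adversarial loss is `O(ε)`, so the regret bound gives, after at
most `1 / (η ε³)` steps, an iterate of adversarial loss `O(ε)` on the sample, which bounds its
error on the sample. By Hoeffding's inequality over a grid of vectors, the error of every halfspace
on the sample is close to its true error up to a slab about the boundary, whose mass
anti-concentration bounds.

Anti-anti-concentration enters twice. No halfspace is robust within distance `r` of its boundary,
where there is mass of order `r`; so `r = O(o)`, and perturbations move `⟨v, x⟩ / ε` by at most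
`B * r / ε = O(ε)`. And every coordinate has a second moment of constant order, so
`d = O(𝔼 ‖x‖_2²) = O(B²)`: a sample of size `B² / o²` affords the union bound over a grid whose
logarithmic size is of order `d`, up to logarithms.
-/

open scoped BigOperators InnerProductSpace

namespace AdvHalfspace

section Hoeffding

variable {Z : Type*} [MeasurableSpace Z] (D : Measure Z) [IsProbabilityMeasure D] {f : Z → ℝ}
  {a b : ℝ}

theorem iIndepFun_pi_sub_integral (hf : Measurable f) (n : ℕ) :
    ProbabilityTheory.iIndepFun (fun i (S : Fin n → Z) => f (S i) - ∫ z, f z ∂D)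
      (Measure.pi fun _ => D) :=
  ProbabilityTheory.iIndepFun_pi (X := fun _ z => f z - ∫ z, f z ∂D)
    fun _ => (hf.sub_const _).aemeasurable

theorem hasSubgaussianMGF_pi_sub_integral (hf : Measurable f) (hfab : ∀ z, f z ∈ Set.Icc a b)
    {n : ℕ} (i : Fin n) :
    ProbabilityTheory.HasSubgaussianMGF (fun S : Fin n → Z => f (S i) - ∫ z, f z ∂D)
      ((‖b - a‖₊ / 2) ^ 2) (Measure.pi fun _ => D) := by
  refine .of_map (Y := fun S : Fin n → Z => S i) (X := fun z => f z - ∫ z, f z ∂D)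
    (measurable_pi_apply i).aemeasurable ?_
  rw [(measurePreserving_eval (fun _ : Fin n => D) i).map_eq]
  exact ProbabilityTheory.hasSubgaussianMGF_of_mem_Icc hf.aemeasurable (.of_forall hfab)

theorem measure_pi_integral_add_le_expect (hf : Measurable f) (hfab : ∀ z, f z ∈ Set.Icc a b)
    {t : ℝ} (ht : 0 ≤ t) (n : ℕ) :
    (Measure.pi fun _ : Fin n => D) {S | ∫ z, f z ∂D + t ≤ 𝔼 i, f (S i)} ≤
      ENNReal.ofReal (Real.exp (-(2 * n * t ^ 2 / (b - a) ^ 2))) := by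
  rcases n.eq_zero_or_pos with rfl | hn
  · simpa using prob_le_one
  have hn' : (0 : ℝ) < n := mod_cast hn
  have hset : {S : Fin n → Z | ∫ z, f z ∂D + t ≤ 𝔼 i, f (S i)} =
      {S | n * t ≤ ∑ i, (f (S i) - ∫ z, f z ∂D)} := by
    ext S
    simp only [Set.mem_ofPred_eq, Fintype.expect_eq_sum_div_card, Fintype.card_fin,
      le_div_iff₀ hn', Finset.sum_sub_distrib, Finset.sum_const, Finset.card_univ, nsmul_eq_mul]
    constructor <;> intro h <;> linarith
  have hoeffding := ProbabilityTheory.HasSubgaussianMGF.measure_sum_ge_le_of_iIndepFun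
    (iIndepFun_pi_sub_integral D hf n)
    (fun i (_ : i ∈ Finset.univ) => hasSubgaussianMGF_pi_sub_integral D hf hfab i)
    (ε := n * t) (by positivity)
  rw [hset, ← ofReal_measureReal]
  refine ENNReal.ofReal_le_ofReal (hoeffding.trans_eq ?_)
  congr 1
  rcases eq_or_ne b a with rfl | hab
  · simp
  have : b - a ≠ 0 := sub_ne_zero.2 hab
  simp only [Finset.sum_const, Finset.card_univ, Fintype.card_fin, nsmul_eq_mul,
    NNReal.coe_mul, NNReal.coe_natCast, NNReal.coe_pow, NNReal.coe_div, coe_nnnorm,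
    NNReal.coe_ofNat, Real.norm_eq_abs, div_pow, sq_abs]
  field_simp

end Hoeffding

section Norms

variable {d : ℕ}

theorem dotProduct_self_eq_vecNorm_sq (x : Fin d → ℝ) : x ⬝ᵥ x = vecNorm 2 x ^ 2 := by
  rw [vecNorm, ← real_inner_self_eq_norm_sq, EuclideanSpace.inner_toLp_toLp]
  simp

theorem abs_dotProduct_le_vecNorm_mul (v x : Fin d → ℝ) :
    |v ⬝ᵥ x| ≤ vecNorm 2 v * vecNorm 2 x := by
  have := abs_real_inner_le_norm (WithLp.toLp 2 x) (WithLp.toLp 2 v)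
  rw [EuclideanSpace.inner_toLp_toLp] at this
  simpa [vecNorm, mul_comm] using this

theorem vecNorm_nonneg {p : ℝ≥0∞} (hp : 1 ≤ p) (x : Fin d → ℝ) : 0 ≤ vecNorm p x := by
  have : Fact (1 ≤ p) := ⟨hp⟩
  exact norm_nonneg (WithLp.toLp p x)

theorem abs_apply_le_vecNorm {p : ℝ≥0∞} (hp : 1 ≤ p) (x : Fin d → ℝ) (i : Fin d) :
    |x i| ≤ vecNorm p x := by
  have : Fact (1 ≤ p) := ⟨hp⟩
  exact PiLp.norm_apply_le (WithLp.toLp p x) i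

theorem vecNorm_eq_sum {p : ℝ≥0∞} (hp : 0 < p.toReal) (x : Fin d → ℝ) :
    vecNorm p x = (∑ i, |x i| ^ p.toReal) ^ (1 / p.toReal) := by
  simp only [vecNorm, PiLp.norm_eq_sum hp, Real.norm_eq_abs]

theorem vecNorm_eq_toReal_eLpNorm {p : ℝ≥0∞} (hp : p ≠ 0) (x : Fin d → ℝ) :
    vecNorm p x = (eLpNorm x p Measure.count).toReal := by
  rcases eq_or_ne p ∞ with rfl | hp'
  · simp only [vecNorm, PiLp.norm_eq_ciSup, eLpNorm_exponent_top, eLpNormEssSup, essSup_count,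
      ENNReal.toReal_iSup fun _ => enorm_ne_top, toReal_enorm]
  · rw [vecNorm_eq_sum (ENNReal.toReal_pos hp hp'),
      eLpNorm_eq_lintegral_rpow_enorm_toReal hp hp', lintegral_count, tsum_fintype,
      ← ENNReal.toReal_rpow,
      ENNReal.toReal_sum fun i _ => ENNReal.rpow_ne_top_of_nonneg (by positivity) enorm_ne_top]
    simp only [← ENNReal.toReal_rpow, toReal_enorm, Real.norm_eq_abs]

theorem vecNorm_le_rpow_mul_vecNorm {p q : ℝ≥0∞} (hp : p ≠ 0) (hpq : p ≤ q) (x : Fin d → ℝ) :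
    vecNorm p x ≤ (d : ℝ) ^ (p⁻¹.toReal - q⁻¹.toReal) * vecNorm q x := by
  have hq : q ≠ 0 := (hp.bot_lt.trans_le hpq).ne'
  have hfin : eLpNorm x q Measure.count ≠ ∞ :=
    (eLpNorm_count_lt_top_of_lt fun _ => enorm_lt_top).ne
  have hexp : 0 ≤ 1 / p.toReal - 1 / q.toReal := by
    simpa only [one_div, ← ENNReal.toReal_inv, sub_nonneg] using
      ENNReal.toReal_mono (ENNReal.inv_ne_top.2 hp) (ENNReal.inv_le_inv.2 hpq)
  have h := ENNReal.toReal_mono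
    (ENNReal.mul_ne_top hfin (ENNReal.rpow_ne_top_of_nonneg hexp (measure_ne_top _ _)))
    (eLpNorm_le_eLpNorm_mul_rpow_measure_univ (μ := Measure.count) hpq
      (StronglyMeasurable.of_discrete (f := x)).aestronglyMeasurable)
  rw [vecNorm_eq_toReal_eLpNorm hp, vecNorm_eq_toReal_eLpNorm hq, mul_comm]
  simpa [ENNReal.toReal_mul, ← ENNReal.toReal_rpow] using h

theorem vecNorm_le_vecNorm_of_exponent_ge {p q : ℝ≥0∞} (hp : 1 ≤ p) (hpq : p ≤ q)
    (x : Fin d → ℝ) : vecNorm q x ≤ vecNorm p x := by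
  rcases eq_or_ne q ∞ with rfl | hq
  · exact Real.iSup_le (fun i => abs_apply_le_vecNorm hp x i) (vecNorm_nonneg hp x)
  have hp0 : 0 < p.toReal :=
    ENNReal.toReal_pos (zero_lt_one.trans_le hp).ne' (hpq.trans_lt hq.lt_top).ne
  have hpq' : p.toReal ≤ q.toReal := ENNReal.toReal_mono hq hpq
  have hq0 : 0 < q.toReal := hp0.trans_le hpq'
  have hc : 0 ≤ vecNorm p x := vecNorm_nonneg hp x
  have hsum : ∑ i, |x i| ^ p.toReal = vecNorm p x ^ p.toReal := by
    rw [vecNorm_eq_sum hp0, ← Real.rpow_mul (by positivity), one_div_mul_cancel hp0.ne',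
      Real.rpow_one]
  rw [vecNorm_eq_sum hq0, one_div, Real.rpow_inv_le_iff_of_pos (by positivity) hc hq0]
  calc ∑ i, |x i| ^ q.toReal
      = ∑ i, |x i| ^ p.toReal * |x i| ^ (q.toReal - p.toReal) := by
        refine Finset.sum_congr rfl fun i _ => ?_
        rw [← Real.rpow_add_of_nonneg (abs_nonneg _) hp0.le (sub_nonneg.2 hpq'),
          add_sub_cancel]
    _ ≤ ∑ i, |x i| ^ p.toReal * vecNorm p x ^ (q.toReal - p.toReal) := by
        gcongr with i
        exact abs_apply_le_vecNorm hp x i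
    _ = vecNorm p x ^ q.toReal := by
        rw [← Finset.sum_mul, hsum, ← Real.rpow_add_of_nonneg hc hp0.le (sub_nonneg.2 hpq'),
          add_sub_cancel]

end Norms

section BoundedDensity

variable {Ω : Type*} [MeasurableSpace Ω] {μ : Measure Ω} {X : Ω → ℝ} {A : ℝ}

theorem measureReal_abs_le_of_map_le (hX : Measurable X) (hA : 0 ≤ A)
    (h : μ.map X ≤ ENNReal.ofReal A • volume) {c : ℝ} (hc : 0 ≤ c) :
    μ.real {ω | |X ω| ≤ c} ≤ A * (2 * c) := by
  refine ENNReal.toReal_le_of_le_ofReal (by positivity) ?_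
  have hset : {ω | |X ω| ≤ c} = X ⁻¹' Set.Icc (-c) c := by
    ext ω
    simp only [Set.mem_ofPred_eq, abs_le, Set.mem_preimage, Set.mem_Icc]
  rw [hset, ← Measure.map_apply hX measurableSet_Icc]
  refine (h _).trans_eq ?_
  rw [Measure.smul_apply, Real.volume_Icc, smul_eq_mul, ← ENNReal.ofReal_mul hA, sub_neg_eq_add,
    two_mul]

theorem integral_exp_neg_abs_div_le_of_map_le (hX : Measurable X) (hA : 0 ≤ A)
    (h : μ.map X ≤ ENNReal.ofReal A • volume) {ε : ℝ} (hε : 0 < ε) :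
    ∫ ω, Real.exp (-(|X ω| / ε)) ∂μ ≤ A * (2 * ε) := by
  have hval : ∫ s : ℝ, Real.exp (-(|s| / ε)) = 2 * ε := by
    rw [integral_comp_abs (f := fun s => Real.exp (-(s / ε)))]
    simp only [div_eq_inv_mul, ← neg_mul]
    rw [integral_exp_mul_Ioi (neg_lt_zero.2 (inv_pos.2 hε))]
    simp
  have hint : Integrable fun s : ℝ => Real.exp (-(|s| / ε)) :=
    .of_integral_ne_zero (by rw [hval]; positivity)
  have hmeas : Measurable fun s : ℝ => Real.exp (-(|s| / ε)) := by fun_prop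
  calc ∫ ω, Real.exp (-(|X ω| / ε)) ∂μ
      = ∫ s, Real.exp (-(|s| / ε)) ∂μ.map X :=
        (integral_map hX.aemeasurable hmeas.aestronglyMeasurable).symm
    _ ≤ ∫ s, Real.exp (-(|s| / ε)) ∂(ENNReal.ofReal A • volume) :=
        integral_mono_measure h (.of_forall fun s => (Real.exp_pos _).le)
          (hint.smul_measure ENNReal.ofReal_ne_top)
    _ = A * (2 * ε) := by
        rw [integral_smul_measure, hval, ENNReal.toReal_ofReal hA, smul_eq_mul]

end BoundedDensity

section Marginals

variable {d : ℕ}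

theorem measurable_dotProduct (v : Fin d → ℝ) : Measurable fun x : Fin d → ℝ => v ⬝ᵥ x := by
  unfold dotProduct
  fun_prop

theorem exists_apply_sq_le_half (hd : 2 ≤ d) {v : Fin d → ℝ} (hv : v ⬝ᵥ v = 1) :
    ∃ i, v i ^ 2 ≤ 1 / 2 := by
  by_contra! h
  have hpair : ∑ i ∈ ({⟨0, by omega⟩, ⟨1, by omega⟩} : Finset (Fin d)), v i * v i ≤ 1 := by
    rw [← hv]
    exact Finset.sum_le_univ_sum_of_nonneg fun i => mul_self_nonneg (v i)
  rw [Finset.sum_pair (by simp)] at hpair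
  linarith [h ⟨0, by omega⟩, h ⟨1, by omega⟩, sq (v ⟨0, by omega⟩), sq (v ⟨1, by omega⟩)]

/- A coordinate in which `v` is small has a component along `v'` of size at least `2 / 3`. As that
coordinate is bounded by `1` on the support, `⟨v', x⟩` is confined to an interval of length at most
`3` once `⟨v, x⟩` is known, whatever the Euclidean norm of `x`. -/
theorem exists_isOrthonormalPair (hd : 2 ≤ d) {v : Fin d → ℝ} (hv : v ⬝ᵥ v = 1) :
    ∃ (i : Fin d) (v' : Fin d → ℝ) (b : ℝ), 2 / 3 ≤ b ∧ IsOrthonormalPair v v' ∧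
      ∀ x : Fin d → ℝ, x i = v i * (v ⬝ᵥ x) + b * (v' ⬝ᵥ x) := by
  obtain ⟨i, hi⟩ := exists_apply_sq_le_half hd hv
  set b := √(1 - v i ^ 2)
  have hb_sq : b ^ 2 = 1 - v i ^ 2 := Real.sq_sqrt (by linarith)
  have hb : 2 / 3 ≤ b := Real.le_sqrt_of_sq_le (by norm_num; linarith)
  have hb_ne : b ≠ 0 := by linarith
  have hdot (x : Fin d → ℝ) :
      (b⁻¹ • (Pi.single i 1 - v i • v)) ⬝ᵥ x = b⁻¹ * (x i - v i * (v ⬝ᵥ x)) := by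
    simp [smul_dotProduct, sub_dotProduct]
  refine ⟨i, b⁻¹ • (Pi.single i 1 - v i • v), b, hb, ⟨hv, ?_, ?_⟩, fun x => ?_⟩
  · rw [hdot, dotProduct_comm, hdot, hv]
    simp only [Pi.smul_apply, Pi.sub_apply, Pi.single_eq_same, smul_eq_mul]
    field_simp
    linarith
  · rw [dotProduct_comm, hdot, hv]
    ring
  · rw [hdot]
    field_simp
    ring

theorem volume_abs_add_mul_le_one_le (a : ℝ) {b : ℝ} (hb : 0 < b) :
    volume {t : ℝ | |a + b * t| ≤ 1} ≤ ENNReal.ofReal (2 / b) := by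
  have hsub : {t : ℝ | |a + b * t| ≤ 1} ⊆ Set.Icc ((-1 - a) / b) ((1 - a) / b) := by
    intro t ht
    obtain ⟨hlower, hupper⟩ := abs_le.1 (show |a + b * t| ≤ 1 from ht)
    exact ⟨by rw [div_le_iff₀ hb]; linarith, by rw [le_div_iff₀ hb]; linarith⟩
  refine (measure_mono hsub).trans_eq ?_
  rw [Real.volume_Icc, ← sub_div]
  ring_nf

theorem AntiConcentrated.map_dotProduct_le {μ : Measure (Fin d → ℝ)} {U : ℝ}
    (hA : AntiConcentrated μ U) (hd : 2 ≤ d) (hμ : ∀ᵐ x ∂μ, ∀ i, |x i| ≤ 1)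
    {v : Fin d → ℝ} (hv : v ⬝ᵥ v = 1) :
    μ.map (fun x => v ⬝ᵥ x) ≤ ENNReal.ofReal (3 * U) • volume := by
  obtain ⟨i, v', b, hb, hvv', hx⟩ := exists_isOrthonormalPair hd hv
  obtain ⟨f, ⟨-, hmap⟩, hfU⟩ := hA v v' hvv'
  have hmeas := (measurable_dotProduct v).prodMk (measurable_dotProduct v')
  refine Measure.le_iff.2 fun E hE => ?_
  set T : Set (ℝ × ℝ) := {z | z.1 ∈ E ∧ |v i * z.1 + b * z.2| ≤ 1}
  have hT : MeasurableSet T :=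
    (measurable_fst hE).inter
      (measurableSet_le (f := fun z : ℝ × ℝ => |v i * z.1 + b * z.2|) (by fun_prop)
        measurable_const)
  have hsec (s : ℝ) : volume (Prod.mk s ⁻¹' T) ≤ E.indicator (fun _ => ENNReal.ofReal 3) s := by
    by_cases hs : s ∈ E
    · rw [Set.indicator_of_mem hs]
      refine (measure_mono fun t ht => ht.2).trans
        ((volume_abs_add_mul_le_one_le (v i * s) (by linarith : 0 < b)).trans
          (ENNReal.ofReal_le_ofReal ?_))
      rw [div_le_iff₀ (by linarith)]
      linarith
    · rw [Set.indicator_of_notMem hs, (by ext t; simp [T, hs] : Prod.mk s ⁻¹' T = ∅),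
        measure_empty]
  calc μ.map (fun x => v ⬝ᵥ x) E = μ ((fun x => v ⬝ᵥ x) ⁻¹' E) :=
        Measure.map_apply (measurable_dotProduct v) hE
    _ ≤ μ ((fun x => (v ⬝ᵥ x, v' ⬝ᵥ x)) ⁻¹' T) := by
        refine measure_mono_ae ?_
        filter_upwards [hμ] with x hx1 hxE
        exact ⟨hxE, by simpa only [← hx x] using hx1 i⟩
    _ = ∫⁻ z in T, f z := by rw [← Measure.map_apply hmeas hT, hmap, withDensity_apply _ hT]
    _ ≤ ∫⁻ _ in T, ENNReal.ofReal U := lintegral_mono fun z => hfU z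
    _ = ENNReal.ofReal U * ∫⁻ s, volume (Prod.mk s ⁻¹' T) := by
        rw [setLIntegral_const, Measure.volume_eq_prod, Measure.prod_apply hT]
    _ ≤ ENNReal.ofReal U * ∫⁻ s, E.indicator (fun _ => ENNReal.ofReal 3) s := by
        gcongr with s
        exact hsec s
    _ = (ENNReal.ofReal (3 * U) • (volume : Measure ℝ)) E := by
        rw [lintegral_indicator hE, setLIntegral_const, Measure.smul_apply, smul_eq_mul,
          ENNReal.ofReal_mul (by norm_num)]
        ring

variable {μ : Measure (Fin d → ℝ)} {U' R : ℝ}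

theorem AntiAntiConcentrated.le_measure_slab (hA : AntiAntiConcentrated μ U' R) (hU' : 0 < U')
    (hd : 2 ≤ d) {v : Fin d → ℝ} (hv : v ⬝ᵥ v = 1) {a b : ℝ} (ha : -(R / 2) ≤ a)
    (hab : a ≤ b) (hb : b ≤ R / 2) :
    ENNReal.ofReal ((b - a) * R / (2 * U')) ≤ μ {x | v ⬝ᵥ x ∈ Set.Icc a b} := by
  obtain ⟨-, v', -, -, hvv', -⟩ := exists_isOrthonormalPair hd hv
  obtain ⟨f, ⟨hf, hmap⟩, hfU'⟩ := hA v v' hvv'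
  have hmeas := (measurable_dotProduct v).prodMk (measurable_dotProduct v')
  set T : Set (ℝ × ℝ) := Set.Icc a b ×ˢ Set.Icc 0 (R / 2)
  have hT : MeasurableSet T := measurableSet_Icc.prod measurableSet_Icc
  have hball : ∀ z ∈ T, ENNReal.ofReal (1 / U') ≤ f z := by
    rintro ⟨s, t⟩ ⟨⟨has, hsb⟩, ht0, htR⟩
    dsimp only at has hsb ht0 htR
    have hs : s ^ 2 ≤ (R / 2) ^ 2 := sq_le_sq' (by linarith) (by linarith)
    have ht : t ^ 2 ≤ (R / 2) ^ 2 := pow_le_pow_left₀ ht0 htR 2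
    exact hfU' _ (by nlinarith)
  calc ENNReal.ofReal ((b - a) * R / (2 * U'))
      = ENNReal.ofReal (1 / U') * volume T := by
        rw [Measure.volume_eq_prod, Measure.prod_prod, Real.volume_Icc, Real.volume_Icc,
          ← ENNReal.ofReal_mul (by linarith), ← ENNReal.ofReal_mul (by positivity)]
        congr 1
        field_simp
        ring
    _ = ∫⁻ _ in T, ENNReal.ofReal (1 / U') := (setLIntegral_const T _).symm
    _ ≤ ∫⁻ z in T, f z := setLIntegral_mono hf hball
    _ = μ ((fun x => (v ⬝ᵥ x, v' ⬝ᵥ x)) ⁻¹' T) := by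
        rw [← withDensity_apply _ hT, ← hmap, Measure.map_apply hmeas hT]
    _ ≤ μ {x | v ⬝ᵥ x ∈ Set.Icc a b} := measure_mono fun x hx => hx.1

theorem AntiAntiConcentrated.le_lintegral_dotProduct_sq (hA : AntiAntiConcentrated μ U' R)
    (hU' : 0 < U') (hR : 0 < R) (hd : 2 ≤ d) {v : Fin d → ℝ} (hv : v ⬝ᵥ v = 1) :
    ENNReal.ofReal (R ^ 4 / (128 * U')) ≤ ∫⁻ x, ENNReal.ofReal ((v ⬝ᵥ x) ^ 2) ∂μ := by
  have hslab := hA.le_measure_slab hU' hd hv (a := R / 4) (b := R / 2) (by linarith)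
    (by linarith) le_rfl
  calc ENNReal.ofReal (R ^ 4 / (128 * U'))
      = ENNReal.ofReal ((R / 4) ^ 2) * ENNReal.ofReal ((R / 2 - R / 4) * R / (2 * U')) := by
        rw [← ENNReal.ofReal_mul (by positivity)]
        congr 1
        field_simp
        ring
    _ ≤ ENNReal.ofReal ((R / 4) ^ 2) *
        μ {x | ENNReal.ofReal ((R / 4) ^ 2) ≤ ENNReal.ofReal ((v ⬝ᵥ x) ^ 2)} := by
        gcongr
        refine hslab.trans (measure_mono fun x hx => ENNReal.ofReal_le_ofReal ?_)
        exact pow_le_pow_left₀ (by positivity) hx.1 2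
    _ ≤ _ := mul_meas_ge_le_lintegral ((measurable_dotProduct v).pow_const 2).ennreal_ofReal _

theorem AntiAntiConcentrated.dim_le [IsProbabilityMeasure μ] (hA : AntiAntiConcentrated μ U' R)
    (hU' : 0 < U') (hR : 0 < R) (hd : 2 ≤ d) {B : ℝ} (hμ : ∀ᵐ x ∂μ, vecNorm 2 x ≤ B) :
    (d : ℝ) ≤ 128 * U' / R ^ 4 * B ^ 2 := by
  have hsum : ENNReal.ofReal (d * (R ^ 4 / (128 * U'))) ≤ ENNReal.ofReal (B ^ 2) :=
    calc ENNReal.ofReal (d * (R ^ 4 / (128 * U')))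
        = ∑ _i : Fin d, ENNReal.ofReal (R ^ 4 / (128 * U')) := by
          rw [ENNReal.ofReal_mul (by positivity)]
          simp
      _ ≤ ∑ i : Fin d, ∫⁻ x, ENNReal.ofReal (x i ^ 2) ∂μ := by
          refine Finset.sum_le_sum fun i _ => ?_
          simpa using hA.le_lintegral_dotProduct_sq hU' hR hd (v := Pi.single i 1) (by simp)
      _ = ∫⁻ x, ∑ i : Fin d, ENNReal.ofReal (x i ^ 2) ∂μ :=
          (lintegral_finsetSum _ fun i _ => by fun_prop).symm
      _ ≤ ∫⁻ _, ENNReal.ofReal (B ^ 2) ∂μ := by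
          refine lintegral_mono_ae ?_
          filter_upwards [hμ] with x hx
          rw [← ENNReal.ofReal_sum_of_nonneg fun i _ => sq_nonneg (x i)]
          have hnorm : ∑ i, x i ^ 2 = vecNorm 2 x ^ 2 := by
            rw [← dotProduct_self_eq_vecNorm_sq]
            simp only [dotProduct, sq]
          rw [hnorm]
          exact ENNReal.ofReal_le_ofReal
            (pow_le_pow_left₀ (vecNorm_nonneg one_le_two x) hx 2)
      _ = ENNReal.ofReal (B ^ 2) := by simp
  calc (d : ℝ) = 128 * U' / R ^ 4 * (d * (R ^ 4 / (128 * U'))) := by field_simp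
    _ ≤ 128 * U' / R ^ 4 * B ^ 2 := by
        gcongr
        exact (ENNReal.ofReal_le_ofReal_iff (sq_nonneg B)).1 hsum

end Marginals

section CrossEntropy

theorem crossEntropy_eq_neg_log_sigmoid (z : ℝ) : crossEntropy z = -Real.log z.sigmoid := by
  rw [Real.sigmoid_def, Real.log_inv, neg_neg, crossEntropy]

theorem hasDerivAt_crossEntropy (z : ℝ) : HasDerivAt crossEntropy (z.sigmoid - 1) z := by
  rw [funext crossEntropy_eq_neg_log_sigmoid]
  convert! ((Real.hasDerivAt_sigmoid z).log z.sigmoid_pos.ne').neg using 1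
  rw [mul_div_cancel_left₀ _ z.sigmoid_pos.ne', neg_sub]

theorem deriv_crossEntropy : deriv crossEntropy = fun z => z.sigmoid - 1 :=
  funext fun z => (hasDerivAt_crossEntropy z).deriv

theorem one_sub_sigmoid_le_crossEntropy (z : ℝ) : 1 - z.sigmoid ≤ crossEntropy z := by
  rw [crossEntropy_eq_neg_log_sigmoid]
  linarith [Real.log_le_sub_one_of_pos z.sigmoid_pos]

theorem crossEntropy_nonneg (z : ℝ) : 0 ≤ crossEntropy z :=
  (sub_nonneg.2 z.sigmoid_le_one).trans (one_sub_sigmoid_le_crossEntropy z)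

theorem half_le_crossEntropy {z : ℝ} (hz : z ≤ 0) : 1 / 2 ≤ crossEntropy z := by
  have := Real.sigmoid_le hz
  rw [Real.sigmoid_zero] at this
  linarith [one_sub_sigmoid_le_crossEntropy z]

theorem crossEntropy_le_exp_neg (z : ℝ) : crossEntropy z ≤ Real.exp (-z) := by
  have := Real.log_le_sub_one_of_pos (by positivity : 0 < 1 + Real.exp (-z))
  rwa [add_sub_cancel_left] at this

theorem deriv_crossEntropy_sq_le (z : ℝ) : deriv crossEntropy z ^ 2 ≤ crossEntropy z := by
  rw [deriv_crossEntropy]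
  nlinarith [one_sub_sigmoid_le_crossEntropy z, z.sigmoid_pos, z.sigmoid_le_one]

theorem convexOn_crossEntropy : ConvexOn ℝ Set.univ crossEntropy := by
  refine Monotone.convexOn_univ_of_deriv
    (fun z => (hasDerivAt_crossEntropy z).differentiableAt) ?_
  rw [deriv_crossEntropy]
  exact Real.sigmoid_monotone.add_const (-1)

theorem add_deriv_mul_sub_le_of_convexOn {f : ℝ → ℝ} (hf : ConvexOn ℝ Set.univ f) {a f' : ℝ}
    (hf' : HasDerivAt f f' a) (b : ℝ) : f a + f' * (b - a) ≤ f b := by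
  rcases lt_trichotomy a b with hab | rfl | hba
  · have h := hf.le_slope_of_hasDerivAt (Set.mem_univ a) (Set.mem_univ b) hab hf'
    rw [slope_def_field, le_div_iff₀ (sub_pos.2 hab)] at h
    linarith
  · simp
  · have h := hf.slope_le_of_hasDerivAt (Set.mem_univ b) (Set.mem_univ a) hba hf'
    rw [slope_def_field, div_le_iff₀ (sub_pos.2 hba)] at h
    linarith

theorem crossEntropy_add_deriv_mul_sub_le (a b : ℝ) :
    crossEntropy a + deriv crossEntropy a * (b - a) ≤ crossEntropy b := by
  rw [(hasDerivAt_crossEntropy a).deriv]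
  exact add_deriv_mul_sub_le_of_convexOn convexOn_crossEntropy (hasDerivAt_crossEntropy a) b

theorem crossEntropy_le_one_add_abs (z : ℝ) : crossEntropy z ≤ 1 + |z| := by
  have hgrad := crossEntropy_add_deriv_mul_sub_le z 0
  have hzero := crossEntropy_le_exp_neg 0
  rw [neg_zero, Real.exp_zero] at hzero
  have hslope : |deriv crossEntropy z * z| ≤ |z| := by
    rw [abs_mul]
    refine mul_le_of_le_one_left (abs_nonneg z) (abs_le.2 ?_)
    rw [deriv_crossEntropy]
    constructor <;> linarith [z.sigmoid_pos, z.sigmoid_le_one]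
  linarith [le_abs_self (deriv crossEntropy z * z)]

end CrossEntropy

section GradientDescent

variable {E : Type*} [NormedAddCommGroup E] [InnerProductSpace ℝ E]

theorem norm_sub_smul_sub_sq_le {w g u : E} {η H a b : ℝ} (hη : 0 ≤ η) (hηH : η * H ≤ 1)
    (ha : 0 ≤ a) (hg : ‖g‖ ^ 2 ≤ H * a) (hinner : a - b ≤ ⟪g, w - u⟫_ℝ) :
    ‖w - η • g - u‖ ^ 2 ≤ ‖w - u‖ ^ 2 - η * (a - 2 * b) := by
  have hsq : η ^ 2 * ‖g‖ ^ 2 ≤ η * a :=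
    calc η ^ 2 * ‖g‖ ^ 2 ≤ η ^ 2 * (H * a) := by gcongr
      _ = η * H * (η * a) := by ring
      _ ≤ 1 * (η * a) := by gcongr
      _ = η * a := one_mul _
  have hlin : η * (a - b) ≤ η * ⟪g, w - u⟫_ℝ := by gcongr
  rw [sub_right_comm, norm_sub_sq_real, inner_smul_right, real_inner_comm, norm_smul, mul_pow,
    Real.norm_eq_abs, sq_abs]
  linarith

theorem exists_le_of_gradient_steps {w g : ℕ → E} {u : E} {a : ℕ → ℝ} {η H b ε : ℝ}
    (hη : 0 < η) (hηH : η * H ≤ 1) (hε : 0 < ε) (hw0 : w 0 = 0)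
    (hw : ∀ k, w (k + 1) = w k - η • g k) (ha : ∀ k, 0 ≤ a k)
    (hg : ∀ k, ‖g k‖ ^ 2 ≤ H * a k) (hinner : ∀ k, a k - b ≤ ⟪g k, w k - u⟫_ℝ) :
    ∃ k : ℕ, (k : ℝ) ≤ ‖u‖ ^ 2 / (η * ε) ∧ a k ≤ 2 * b + ε := by
  by_contra! hcon
  set T := ‖u‖ ^ 2 / (η * ε) with hT
  have hdecrease (K : ℕ) (hK : (K : ℝ) ≤ T + 1) : ‖w K - u‖ ^ 2 ≤ ‖u‖ ^ 2 - η * ε * K := by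
    induction K with
    | zero => simp [hw0]
    | succ K ih =>
      push_cast at hK ⊢
      have hstep := norm_sub_smul_sub_sq_le hη.le hηH (ha K) (hg K) (hinner K)
      have hlarge := mul_le_mul_of_nonneg_left (hcon K (by linarith)).le hη.le
      rw [hw K]
      linarith [ih (by linarith)]
  have hT0 : 0 ≤ T := by positivity
  have hlast := hdecrease (⌊T⌋₊ + 1) (by push_cast; linarith [Nat.floor_le hT0])
  have hu : ‖u‖ ^ 2 = η * ε * T := by rw [hT]; field_simp
  have hlt : η * ε * T < η * ε * (⌊T⌋₊ + 1) := by
    gcongr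
    exact Nat.lt_floor_add_one T
  push_cast at hlast
  linarith [sq_nonneg ‖w (⌊T⌋₊ + 1) - u‖]

variable {ι : Type*} [Fintype ι]

/-- The empirical cross-entropy risk of the linear classifier `w` on the data `x` with labels
`y`. -/
noncomputable def crossEntropyRisk (y : ι → ℝ) (x : ι → E) (w : E) : ℝ :=
  𝔼 i, crossEntropy (y i * ⟪w, x i⟫_ℝ)

/-- The gradient of `crossEntropyRisk` in the classifier, with the data held fixed. -/
noncomputable def crossEntropyRiskGradient (y : ι → ℝ) (x : ι → E) (w : E) : E :=
  (Fintype.card ι : ℝ)⁻¹ • ∑ i, (deriv crossEntropy (y i * ⟪w, x i⟫_ℝ) * y i) • x i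

theorem crossEntropyRisk_nonneg (y : ι → ℝ) (x : ι → E) (w : E) : 0 ≤ crossEntropyRisk y x w :=
  Finset.expect_nonneg fun _ _ => crossEntropy_nonneg _

theorem norm_crossEntropyRiskGradient_sq_le {y : ι → ℝ} {x : ι → E} (hy : ∀ i, |y i| = 1) {H : ℝ}
    (hx : ∀ i, ‖x i‖ ≤ H) (w : E) :
    ‖crossEntropyRiskGradient y x w‖ ^ 2 ≤ H ^ 2 * crossEntropyRisk y x w := by
  rcases isEmpty_or_nonempty ι with hι | ⟨⟨i₀⟩⟩
  · simp [crossEntropyRiskGradient, crossEntropyRisk]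
  have : 0 ≤ H := (norm_nonneg _).trans (hx i₀)
  set c : ι → ℝ := fun i => deriv crossEntropy (y i * ⟪w, x i⟫_ℝ)
  have hnorm : ‖crossEntropyRiskGradient y x w‖ ≤ (∑ i, |c i|) / Fintype.card ι * H := by
    rw [crossEntropyRiskGradient, norm_smul, norm_inv, RCLike.norm_natCast, div_mul_eq_mul_div,
      div_eq_inv_mul, Finset.sum_mul]
    gcongr
    refine norm_sum_le_of_le _ fun i _ => ?_
    rw [norm_smul, Real.norm_eq_abs, abs_mul, hy i, mul_one]
    exact mul_le_mul_of_nonneg_left (hx i) (abs_nonneg _)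
  calc ‖crossEntropyRiskGradient y x w‖ ^ 2
      ≤ ((∑ i, |c i|) / Fintype.card ι * H) ^ 2 := by gcongr
    _ = H ^ 2 * ((∑ i, |c i|) / Fintype.card ι) ^ 2 := by ring
    _ ≤ H ^ 2 * ((∑ i, |c i| ^ 2) / Fintype.card ι) := by
        gcongr
        exact sum_div_card_sq_le_sum_sq_div_card (s := Finset.univ) (f := fun i => |c i|)
    _ ≤ H ^ 2 * crossEntropyRisk y x w := by
        rw [crossEntropyRisk, Fintype.expect_eq_sum_div_card]
        gcongr with i
        rw [sq_abs]
        exact deriv_crossEntropy_sq_le _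

theorem crossEntropyRisk_sub_le_inner (y : ι → ℝ) (x : ι → E) (w u : E) :
    crossEntropyRisk y x w - crossEntropyRisk y x u ≤
      ⟪crossEntropyRiskGradient y x w, w - u⟫_ℝ := by
  rw [crossEntropyRiskGradient, real_inner_smul_left, sum_inner, crossEntropyRisk,
    crossEntropyRisk, ← Finset.expect_sub_distrib, Fintype.expect_eq_sum_div_card,
    div_eq_inv_mul]
  gcongr with i
  rw [real_inner_smul_left, real_inner_comm (w - u), inner_sub_left]
  linarith [crossEntropy_add_deriv_mul_sub_le (y i * ⟪w, x i⟫_ℝ) (y i * ⟪u, x i⟫_ℝ)]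

end GradientDescent

section RobustError

theorem sign_ne_iff_mul_nonpos {y t : ℝ} (hy : y = 1 ∨ y = -1) :
    Real.sign t ≠ y ↔ y * t ≤ 0 := by
  rcases lt_trichotomy t 0 with ht | rfl | ht
  · rw [Real.sign_of_neg ht]
    rcases hy with rfl | rfl <;> norm_num <;> linarith
  · rcases hy with rfl | rfl <;> norm_num
  · rw [Real.sign_of_pos ht]
    rcases hy with rfl | rfl <;> norm_num <;> linarith

theorem sign_mul_of_pos {c : ℝ} (hc : 0 < c) (t : ℝ) : Real.sign (c * t) = Real.sign t := by
  have hneg : c * t < 0 ↔ t < 0 := smul_neg_iff_of_pos_left hc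
  simp only [Real.sign, hneg, mul_pos_iff_of_pos_left hc]

variable {d : ℕ} {D : Measure ((Fin d → ℝ) × ℝ)} {p q : ℝ≥0∞} {r : ℝ}

theorem measurable_dotProduct_fst (v : Fin d → ℝ) :
    Measurable fun z : (Fin d → ℝ) × ℝ => v ⬝ᵥ z.1 :=
  (measurable_dotProduct v).comp measurable_fst

theorem exists_pos_smul_unit {w : Fin d → ℝ} (hw : w ≠ 0) :
    ∃ (c : ℝ) (v : Fin d → ℝ), 0 < c ∧ v ⬝ᵥ v = 1 ∧ w = c • v := by
  have hpos : 0 < w ⬝ᵥ w :=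
    (Finset.sum_nonneg fun i _ => mul_self_nonneg (w i)).lt_of_ne fun h =>
      hw (dotProduct_self_eq_zero.1 h.symm)
  have hc : 0 < √(w ⬝ᵥ w) := Real.sqrt_pos.2 hpos
  refine ⟨√(w ⬝ᵥ w), (√(w ⬝ᵥ w))⁻¹ • w, hc, ?_, (smul_inv_smul₀ hc.ne' w).symm⟩
  rw [smul_dotProduct, dotProduct_smul, smul_eq_mul, smul_eq_mul, ← mul_assoc, ← mul_inv,
    Real.mul_self_sqrt hpos.le, inv_mul_cancel₀ hpos.ne']

theorem robustError_smul {c : ℝ} (hc : 0 < c) (w : Fin d → ℝ) :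
    robustError D p r (c • w) = robustError D p r w := by
  simp only [robustError, smul_dotProduct, smul_eq_mul, sign_mul_of_pos hc]

/-- The probability that the halfspace `w` classifies a point with margin at most `s`. For `s = 0`
this is the standard classification error. -/
noncomputable def marginError (D : Measure ((Fin d → ℝ) × ℝ)) (w : Fin d → ℝ) (s : ℝ) : ℝ :=
  D.real {z | z.2 * (w ⬝ᵥ z.1) ≤ s}

theorem measureReal_le_of_ae_imp {α : Type*} [MeasurableSpace α] {μ : Measure α}
    [IsFiniteMeasure μ] {s t : Set α} (h : ∀ᵐ a ∂μ, a ∈ s → a ∈ t) : μ.real s ≤ μ.real t :=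
  ENNReal.toReal_mono (measure_ne_top μ t) (measure_mono_ae h)

theorem marginError_zero_le_robustError [IsFiniteMeasure D] (hp : p ≠ 0) (hr : 0 ≤ r)
    (hy : ∀ᵐ z ∂D, z.2 = 1 ∨ z.2 = -1) (w : Fin d → ℝ) :
    marginError D w 0 ≤ robustError D p r w := by
  refine measureReal_le_of_ae_imp ?_
  filter_upwards [hy] with z hz herr
  refine ⟨z.1, ?_, (sign_ne_iff_mul_nonpos hz).2 herr⟩
  simpa [vecNorm_eq_toReal_eLpNorm hp] using hr

theorem robustError_le_marginError [IsFiniteMeasure D] {w : Fin d → ℝ} {b : ℝ}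
    (hw : ∀ δ : Fin d → ℝ, vecNorm p δ ≤ r → |w ⬝ᵥ δ| ≤ b)
    (hy : ∀ᵐ z ∂D, z.2 = 1 ∨ z.2 = -1) : robustError D p r w ≤ marginError D w b := by
  refine measureReal_le_of_ae_imp ?_
  filter_upwards [hy] with z hz ⟨x', hx', hsign⟩
  rw [sign_ne_iff_mul_nonpos hz] at hsign
  have hshift := abs_le.1 (hw _ hx')
  rw [dotProduct_sub] at hshift
  change z.2 * (w ⬝ᵥ z.1) ≤ b
  rcases hz with h | h <;> rw [h] at hsign ⊢ <;> linarith

theorem exists_dotProduct_eq_zero (hp : 2 ≤ p) {v : Fin d → ℝ} (hv : v ⬝ᵥ v = 1)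
    (x : Fin d → ℝ) : ∃ x' : Fin d → ℝ, vecNorm p (x' - x) ≤ |v ⬝ᵥ x| ∧ v ⬝ᵥ x' = 0 := by
  refine ⟨x - (v ⬝ᵥ x) • v, ?_, by simp [dotProduct_sub, dotProduct_smul, hv]⟩
  refine (vecNorm_le_vecNorm_of_exponent_ge one_le_two hp _).trans
    (le_of_sq_le_sq ?_ (abs_nonneg _))
  rw [← dotProduct_self_eq_vecNorm_sq, sub_sub_cancel_left, neg_dotProduct_neg, smul_dotProduct,
    dotProduct_smul, hv, sq_abs, smul_eq_mul, smul_eq_mul, mul_one, sq]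

/- Points within distance `r` of the decision boundary are misclassified by every halfspace, so
anti-anti-concentration forces a robust error of order `r`. -/
theorem AntiAntiConcentrated.le_robustError [IsFiniteMeasure D] {U' R : ℝ}
    (hA : AntiAntiConcentrated D.fst U' R) (hU' : 0 < U') (hR : 0 ≤ R) (hd : 2 ≤ d) (hp : 2 ≤ p)
    (hr : 0 ≤ r) (hy : ∀ᵐ z ∂D, z.2 = 1 ∨ z.2 = -1) {w : Fin d → ℝ} (hw : w ≠ 0) :
    min r R * R / (2 * U') ≤ robustError D p r w := by
  obtain ⟨c, v, hc, hv, rfl⟩ := exists_pos_smul_unit hw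
  rw [robustError_smul hc]
  set h := min r R
  have hh : 0 ≤ h := le_min hr hR
  have hhr : h ≤ r := min_le_left r R
  have hhR : h ≤ R := min_le_right r R
  have hslab := hA.le_measure_slab hU' hd hv (a := -(h / 2)) (b := h / 2) (by linarith)
    (by linarith) (by linarith)
  have hmeas : MeasurableSet {x : Fin d → ℝ | v ⬝ᵥ x ∈ Set.Icc (-(h / 2)) (h / 2)} :=
    measurable_dotProduct v measurableSet_Icc
  rw [Measure.fst_apply hmeas,
    ENNReal.ofReal_le_iff_le_toReal (measure_ne_top D _)] at hslab
  calc h * R / (2 * U') = (h / 2 - -(h / 2)) * R / (2 * U') := by ring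
    _ ≤ D.real (Prod.fst ⁻¹' {x | v ⬝ᵥ x ∈ Set.Icc (-(h / 2)) (h / 2)}) := hslab
    _ ≤ robustError D p r v := by
      refine measureReal_le_of_ae_imp ?_
      filter_upwards [hy] with z hz hzslab
      obtain ⟨x', hx', hx'0⟩ := exists_dotProduct_eq_zero hp hv z.1
      refine ⟨x', hx'.trans ((abs_le.2 hzslab).trans (by linarith)), ?_⟩
      rw [sign_ne_iff_mul_nonpos hz, hx'0, mul_zero]

theorem robustOpt_le_one [IsProbabilityMeasure D] : robustOpt D p q r ≤ 1 := by
  rcases isEmpty_or_nonempty {w : Fin d → ℝ // vecNorm q w = 1} with _ | ⟨⟨w⟩⟩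
  · simp [robustOpt, Real.iInf_of_isEmpty]
  · refine (ciInf_le ⟨0, ?_⟩ w).trans measureReal_le_one
    rintro _ ⟨w, rfl⟩
    exact measureReal_nonneg

theorem ne_zero_of_vecNorm_eq_one (hq : q ≠ 0) {w : Fin d → ℝ} (hw : vecNorm q w = 1) : w ≠ 0 := by
  rintro rfl
  simp [vecNorm_eq_toReal_eLpNorm hq] at hw

theorem nonempty_of_robustOpt_pos (ho : 0 < robustOpt D p q r) :
    Nonempty {w : Fin d → ℝ // vecNorm q w = 1} := by
  by_contra h
  rw [not_nonempty_iff] at h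
  simp [robustOpt, Real.iInf_of_isEmpty] at ho

theorem le_robustOpt (hq : q ≠ 0) (ho : 0 < robustOpt D p q r) {a : ℝ}
    (h : ∀ w : Fin d → ℝ, w ≠ 0 → a ≤ robustError D p r w) : a ≤ robustOpt D p q r := by
  have := nonempty_of_robustOpt_pos ho
  exact le_ciInf fun w => h w (ne_zero_of_vecNorm_eq_one hq w.2)

theorem exists_robustError_lt_two_mul_robustOpt (hq : q ≠ 0) (ho : 0 < robustOpt D p q r) :
    ∃ v : Fin d → ℝ, v ⬝ᵥ v = 1 ∧ robustError D p r v < 2 * robustOpt D p q r := by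
  have := nonempty_of_robustOpt_pos ho
  obtain ⟨⟨w, hw⟩, hlt⟩ := exists_lt_of_ciInf_lt (lt_two_mul_self ho)
  obtain ⟨c, v, hc, hv, rfl⟩ := exists_pos_smul_unit (ne_zero_of_vecNorm_eq_one hq hw)
  exact ⟨v, hv, by rwa [robustError_smul hc] at hlt⟩

end RobustError

section UniformConvergence

variable {d n : ℕ}

/-- The vectors in `[-1, 1]^d` whose coordinates are multiples of `1 / N`. -/
noncomputable def gridVector (N : ℕ) (j : Fin d → Fin (2 * N + 1)) : Fin d → ℝ :=
  fun i => ((j i : ℕ) - N : ℝ) / N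

theorem exists_abs_sub_gridVector_le {N : ℕ} (hN : 0 < N) {w : Fin d → ℝ} (hw : ∀ i, |w i| ≤ 1) :
    ∃ j, ∀ i, |w i - gridVector N j i| ≤ 1 / N := by
  have hN' : (0 : ℝ) < N := by exact_mod_cast hN
  have hnonneg (i : Fin d) : 0 ≤ (w i + 1) * N :=
    mul_nonneg (by linarith [(abs_le.1 (hw i)).1]) hN'.le
  have hlt (i : Fin d) : ⌊(w i + 1) * N⌋₊ < 2 * N + 1 := by
    refine Nat.lt_succ_of_le (Nat.floor_le_of_le ?_)
    push_cast
    gcongr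
    linarith [(abs_le.1 (hw i)).2]
  refine ⟨fun i => ⟨_, hlt i⟩, fun i => ?_⟩
  have hrem : w i - gridVector N (fun i => ⟨_, hlt i⟩) i =
      ((w i + 1) * N - ⌊(w i + 1) * N⌋₊) / N := by
    simp only [gridVector]
    field_simp
    ring
  rw [hrem, abs_of_nonneg (div_nonneg (sub_nonneg.2 (Nat.floor_le (hnonneg i))) hN'.le)]
  gcongr
  linarith [Nat.lt_floor_add_one ((w i + 1) * N)]

theorem abs_dotProduct_sub_dotProduct_le {v w x : Fin d → ℝ} {h : ℝ}
    (hvw : ∀ i, |v i - w i| ≤ h) (hx : ∀ i, |x i| ≤ 1) : |v ⬝ᵥ x - w ⬝ᵥ x| ≤ d * h := by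
  rw [← sub_dotProduct]
  calc |(v - w) ⬝ᵥ x| ≤ ∑ i, |(v - w) i * x i| := Finset.abs_sum_le_sum_abs _ _
    _ ≤ ∑ _i : Fin d, h := by
        refine Finset.sum_le_sum fun i _ => ?_
        rw [abs_mul]
        exact (mul_le_of_le_one_right (abs_nonneg _) (hx i)).trans (hvw i)
    _ = d * h := by simp

/-- The fraction of the sample that the halfspace `w` classifies with margin at most `s`: the
empirical counterpart of `marginError`. -/
noncomputable def empiricalMarginError (S : Fin n → (Fin d → ℝ) × ℝ) (w : Fin d → ℝ) (s : ℝ) : ℝ :=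
  𝔼 i, if (S i).2 * (w ⬝ᵥ (S i).1) ≤ s then 1 else 0

theorem empiricalMarginError_mono {S : Fin n → (Fin d → ℝ) × ℝ} {w w' : Fin d → ℝ} {s s' : ℝ}
    (h : ∀ i, (S i).2 * (w ⬝ᵥ (S i).1) ≤ s → (S i).2 * (w' ⬝ᵥ (S i).1) ≤ s') :
    empiricalMarginError S w s ≤ empiricalMarginError S w' s' := by
  refine Finset.expect_le_expect fun i _ => ?_
  split_ifs with hi hi'
  exacts [le_rfl, absurd (h i hi) hi', zero_le_one, le_rfl]

theorem empiricalMarginError_zero_left [NeZero n] (S : Fin n → (Fin d → ℝ) × ℝ) :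
    empiricalMarginError S 0 0 = 1 := by
  simp [empiricalMarginError]

theorem empiricalMarginError_smul {c : ℝ} (hc : 0 < c) (S : Fin n → (Fin d → ℝ) × ℝ)
    (w : Fin d → ℝ) : empiricalMarginError S (c • w) 0 = empiricalMarginError S w 0 := by
  have hscale (i : Fin n) : (S i).2 * ((c • w) ⬝ᵥ (S i).1) ≤ 0 ↔ (S i).2 * (w ⬝ᵥ (S i).1) ≤ 0 := by
    rw [smul_dotProduct, mul_smul_comm, smul_nonpos_iff_nonpos_of_pos_left hc]
  simp only [empiricalMarginError, hscale]

variable {D : Measure ((Fin d → ℝ) × ℝ)}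

theorem measurableSet_mul_dotProduct_le (w : Fin d → ℝ) (s : ℝ) :
    MeasurableSet {z : (Fin d → ℝ) × ℝ | z.2 * (w ⬝ᵥ z.1) ≤ s} :=
  measurableSet_le (measurable_snd.mul (measurable_dotProduct_fst w)) measurable_const

theorem measure_pi_empiricalMarginError_add_le [IsProbabilityMeasure D] (w : Fin d → ℝ) (s : ℝ)
    {t : ℝ} (ht : 0 ≤ t) (n : ℕ) :
    Measure.pi (fun _ : Fin n => D) {S | empiricalMarginError S w s + t ≤ marginError D w s} ≤
      ENNReal.ofReal (Real.exp (-(2 * n * t ^ 2))) := by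
  set E : Set ((Fin d → ℝ) × ℝ) := {z | z.2 * (w ⬝ᵥ z.1) ≤ s}
  have hE : MeasurableSet E := measurableSet_mul_dotProduct_le w s
  have h := measure_pi_integral_add_le_expect D (f := -E.indicator 1) (a := -1) (b := 0)
    (measurable_one.indicator hE).neg (fun z => ?_) ht n
  · have hint : ∫ z, (-E.indicator 1) z ∂D = -marginError D w s := by
      simp only [Pi.neg_apply]
      rw [integral_neg, integral_indicator_one hE]
      rfl
    have hemp (S : Fin n → (Fin d → ℝ) × ℝ) :
        𝔼 i, (-E.indicator (1 : (Fin d → ℝ) × ℝ → ℝ)) (S i) = -empiricalMarginError S w s := by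
      simp only [Pi.neg_apply, Finset.expect_neg_distrib, Set.indicator_apply]
      rfl
    rw [hint] at h
    simp only [hemp] at h
    convert h using 4
    · exact ⟨fun _ => by linarith, fun _ => by linarith⟩
    · norm_num
  · by_cases hz : z ∈ E <;> simp [hz]

theorem measure_pi_exists_empiricalMarginError_add_le [IsProbabilityMeasure D] {ι : Type*}
    [Fintype ι] (w : ι → Fin d → ℝ) (s : ℝ) {t : ℝ} (ht : 0 ≤ t) (n : ℕ) :
    Measure.pi (fun _ : Fin n => D)
        {S | ∃ j, empiricalMarginError S (w j) s + t ≤ marginError D (w j) s} ≤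
      ENNReal.ofReal (Fintype.card ι * Real.exp (-(2 * n * t ^ 2))) := by
  rw [Set.ofPred_exists]
  refine (measure_iUnion_fintype_le _ _).trans ?_
  refine (Finset.sum_le_sum fun j _ => measure_pi_empiricalMarginError_add_le (w j) s ht n).trans_eq
    ?_
  rw [Finset.sum_const, nsmul_eq_mul, ENNReal.ofReal_mul (Nat.cast_nonneg _),
    ENNReal.ofReal_natCast, Finset.card_univ]

theorem marginError_le_marginError_add [IsFiniteMeasure D] {v v' : Fin d → ℝ} {ρ b : ℝ}
    (hb : 0 ≤ b) (hy : ∀ᵐ z ∂D, z.2 = 1 ∨ z.2 = -1) (hvv' : ∀ᵐ z ∂D, |v ⬝ᵥ z.1 - v' ⬝ᵥ z.1| ≤ ρ) :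
    marginError D v b ≤ marginError D v' (-ρ) + D.real {z | |v ⬝ᵥ z.1| ≤ 2 * ρ + b} := by
  refine le_trans (measureReal_le_of_ae_imp ?_) (measureReal_union_le _ _)
  filter_upwards [hy, hvv'] with z hz hclose hzb
  change z.2 * (v ⬝ᵥ z.1) ≤ b at hzb
  refine or_iff_not_imp_left.2 fun hmargin => ?_
  change ¬ z.2 * (v' ⬝ᵥ z.1) ≤ -ρ at hmargin
  obtain ⟨hlower, hupper⟩ := abs_le.1 hclose
  change |v ⬝ᵥ z.1| ≤ 2 * ρ + b
  rw [abs_le]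
  rcases hz with h | h <;> rw [h] at hzb hmargin <;> constructor <;> linarith

theorem robustError_le_empiricalMarginError_add [IsProbabilityMeasure D] [NeZero n]
    {p : ℝ≥0∞} {r b A t : ℝ} {N : ℕ} (hN : 0 < N) (hb : 0 ≤ b) (hA : 0 ≤ A) (ht : 0 ≤ t)
    (hpert : ∀ v δ : Fin d → ℝ, v ⬝ᵥ v = 1 → vecNorm p δ ≤ r → |v ⬝ᵥ δ| ≤ b)
    (hy : ∀ᵐ z ∂D, z.2 = 1 ∨ z.2 = -1) (hx : ∀ᵐ z ∂D, ∀ i, |z.1 i| ≤ 1)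
    (hdens : ∀ v : Fin d → ℝ, v ⬝ᵥ v = 1 →
      D.map (fun z => v ⬝ᵥ z.1) ≤ ENNReal.ofReal A • volume)
    {S : Fin n → (Fin d → ℝ) × ℝ} (hyS : ∀ i, (S i).2 = 1 ∨ (S i).2 = -1)
    (hxS : ∀ i l, |(S i).1 l| ≤ 1)
    (hgrid : ∀ j : Fin d → Fin (2 * N + 1), marginError D (gridVector N j) (-(d * (1 / N))) <
      empiricalMarginError S (gridVector N j) (-(d * (1 / N))) + t) (w : Fin d → ℝ) :
    robustError D p r w ≤ empiricalMarginError S w 0 + t + A * (2 * (2 * (d * (1 / N)) + b)) := by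
  set ρ : ℝ := d * (1 / N)
  have : 0 ≤ ρ := by positivity
  rcases eq_or_ne w 0 with rfl | hw
  · have herr : robustError D p r 0 ≤ 1 := measureReal_le_one
    have hslack : 0 ≤ t + A * (2 * (2 * ρ + b)) := by positivity
    rw [empiricalMarginError_zero_left]
    linarith
  obtain ⟨c, v, hc, hv, rfl⟩ := exists_pos_smul_unit hw
  rw [robustError_smul hc, empiricalMarginError_smul hc]
  have hv1 (i : Fin d) : |v i| ≤ 1 := by
    rw [abs_le_one_iff_mul_self_le_one, ← hv]
    exact Finset.single_le_sum (fun i _ => mul_self_nonneg (v i)) (Finset.mem_univ i)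
  obtain ⟨j, hj⟩ := exists_abs_sub_gridVector_le hN hv1
  have hclose {x : Fin d → ℝ} (hx : ∀ i, |x i| ≤ 1) : |v ⬝ᵥ x - gridVector N j ⬝ᵥ x| ≤ ρ :=
    abs_dotProduct_sub_dotProduct_le hj hx
  have hemp : empiricalMarginError S (gridVector N j) (-ρ) ≤ empiricalMarginError S v 0 := by
    refine empiricalMarginError_mono fun i hi => ?_
    obtain ⟨hlower, hupper⟩ := abs_le.1 (hclose (hxS i))
    rcases hyS i with h | h <;> rw [h] at hi ⊢ <;> linarith
  calc robustError D p r v ≤ marginError D v b :=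
        robustError_le_marginError (fun δ hδ => hpert v δ hv hδ) hy
    _ ≤ marginError D (gridVector N j) (-ρ) + D.real {z | |v ⬝ᵥ z.1| ≤ 2 * ρ + b} :=
        marginError_le_marginError_add hb hy (hx.mono fun z hz => hclose hz)
    _ ≤ (empiricalMarginError S v 0 + t) + A * (2 * (2 * ρ + b)) :=
        add_le_add ((hgrid j).le.trans (by gcongr)) (measureReal_abs_le_of_map_le
          (measurable_dotProduct_fst v) hA (hdens v hv) (by positivity))

end UniformConvergence

section Competitor

variable {d : ℕ} {D : Measure ((Fin d → ℝ) × ℝ)}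

/-- An upper bound for the adversarial cross-entropy loss of the competitor `ε⁻¹ • v` at `z`, when
perturbations change `⟨v, x⟩ / ε` by at most `κ` and `|⟨v, x⟩| / ε` stays below `M` under them. -/
noncomputable def competitorLoss (v : Fin d → ℝ) (ε κ M : ℝ) (z : (Fin d → ℝ) × ℝ) : ℝ :=
  Real.exp κ * Real.exp (-(|v ⬝ᵥ z.1| / ε)) +
    (1 + M) * {z : (Fin d → ℝ) × ℝ | z.2 * (v ⬝ᵥ z.1) ≤ 0}.indicator 1 z

theorem crossEntropy_le_competitorLoss {v x δ : Fin d → ℝ} {y ε κ M : ℝ} (hε : 0 < ε)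
    (hy : y = 1 ∨ y = -1) (hκ : |v ⬝ᵥ δ| ≤ κ * ε) (hM : |v ⬝ᵥ (x + δ)| ≤ M * ε) :
    crossEntropy (y * ((ε⁻¹ • v) ⬝ᵥ (x + δ))) ≤ competitorLoss v ε κ M (x, y) := by
  have hyabs : |y| = 1 := by rcases hy with rfl | rfl <;> simp
  have hscale : y * ((ε⁻¹ • v) ⬝ᵥ (x + δ)) = y * (v ⬝ᵥ (x + δ)) / ε := by
    rw [smul_dotProduct, smul_eq_mul]
    ring
  rw [hscale, competitorLoss, ← Real.exp_add]
  by_cases hxy : y * (v ⬝ᵥ x) ≤ 0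
  · rw [Set.indicator_of_mem (by exact hxy), Pi.one_apply, mul_one]
    have hmargin : |y * (v ⬝ᵥ (x + δ)) / ε| ≤ M := by
      rwa [abs_div, abs_mul, hyabs, one_mul, abs_of_pos hε, div_le_iff₀ hε]
    linarith [crossEntropy_le_one_add_abs (y * (v ⬝ᵥ (x + δ)) / ε),
      Real.exp_pos (κ + -(|v ⬝ᵥ x| / ε))]
  · rw [Set.indicator_of_notMem (by exact hxy), mul_zero, add_zero]
    refine (crossEntropy_le_exp_neg _).trans (Real.exp_le_exp.2 ?_)
    have hshift : |y * (v ⬝ᵥ δ)| ≤ κ * ε := by rwa [abs_mul, hyabs, one_mul]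
    have hx : |v ⬝ᵥ x| = y * (v ⬝ᵥ x) := by
      rw [← one_mul |v ⬝ᵥ x|, ← hyabs, ← abs_mul, abs_of_pos (not_le.1 hxy)]
    have hκ' : -(y * (v ⬝ᵥ δ)) / ε ≤ κ := (div_le_iff₀ hε).2 (by linarith [(abs_le.1 hshift).1])
    calc -(y * (v ⬝ᵥ (x + δ)) / ε) = -(y * (v ⬝ᵥ δ)) / ε + -(y * (v ⬝ᵥ x) / ε) := by
          rw [dotProduct_add]
          ring
      _ ≤ κ + -(|v ⬝ᵥ x| / ε) := by
          rw [hx]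
          gcongr

theorem measurable_exp_neg_abs_dotProduct_div (v : Fin d → ℝ) (ε : ℝ) :
    Measurable fun z : (Fin d → ℝ) × ℝ => Real.exp (-(|v ⬝ᵥ z.1| / ε)) := by
  have := measurable_dotProduct_fst v
  fun_prop

theorem measurable_competitorLoss (v : Fin d → ℝ) (ε κ M : ℝ) :
    Measurable (competitorLoss v ε κ M) :=
  ((measurable_exp_neg_abs_dotProduct_div v ε).const_mul _).add
    ((measurable_one.indicator (measurableSet_mul_dotProduct_le v 0)).const_mul _)

theorem exp_neg_abs_div_mem_Icc {ε : ℝ} (hε : 0 ≤ ε) (s : ℝ) :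
    Real.exp (-(|s| / ε)) ∈ Set.Icc (0 : ℝ) 1 :=
  ⟨(Real.exp_pos _).le, Real.exp_le_one_iff.2 (neg_nonpos.2 (by positivity))⟩

theorem competitorLoss_mem_Icc {ε M : ℝ} (hε : 0 ≤ ε) (hM : 0 ≤ M) (v : Fin d → ℝ) (κ : ℝ)
    (z : (Fin d → ℝ) × ℝ) :
    competitorLoss v ε κ M z ∈ Set.Icc 0 (Real.exp κ + (1 + M)) := by
  have hexp := exp_neg_abs_div_mem_Icc hε (v ⬝ᵥ z.1)
  have hind : {z : (Fin d → ℝ) × ℝ | z.2 * (v ⬝ᵥ z.1) ≤ 0}.indicator 1 z ∈ Set.Icc (0 : ℝ) 1 := by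
    rw [Set.indicator_apply]
    split_ifs <;> simp
  have hM' : 0 ≤ 1 + M := by positivity
  exact ⟨add_nonneg (mul_nonneg (Real.exp_pos κ).le hexp.1) (mul_nonneg hM' hind.1),
    add_le_add (mul_le_of_le_one_right (Real.exp_pos κ).le hexp.2)
      (mul_le_of_le_one_right hM' hind.2)⟩

theorem integral_competitorLoss_le [IsFiniteMeasure D] {A : ℝ} (hA : 0 ≤ A) {v : Fin d → ℝ}
    (hv : D.map (fun z => v ⬝ᵥ z.1) ≤ ENNReal.ofReal A • volume) {ε : ℝ} (hε : 0 < ε) (κ M : ℝ) :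
    ∫ z, competitorLoss v ε κ M z ∂D ≤
      Real.exp κ * (A * (2 * ε)) + (1 + M) * marginError D v 0 := by
  have hset := measurableSet_mul_dotProduct_le v 0
  have hexp : Integrable (fun z : (Fin d → ℝ) × ℝ => Real.exp (-(|v ⬝ᵥ z.1| / ε))) D :=
    .of_mem_Icc 0 1 (measurable_exp_neg_abs_dotProduct_div v ε).aemeasurable
      (.of_forall fun z => exp_neg_abs_div_mem_Icc hε.le _)
  have hind : Integrable ({z : (Fin d → ℝ) × ℝ | z.2 * (v ⬝ᵥ z.1) ≤ 0}.indicator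
      (1 : (Fin d → ℝ) × ℝ → ℝ)) D := (integrable_const 1).indicator hset
  unfold competitorLoss
  rw [integral_add (hexp.const_mul _) (hind.const_mul _), integral_const_mul, integral_const_mul,
    integral_indicator_one hset]
  exact add_le_add (mul_le_mul_of_nonneg_left (integral_exp_neg_abs_div_le_of_map_le
    (measurable_dotProduct_fst v) hA hv hε) (Real.exp_pos κ).le) le_rfl

end Competitor

section AdversarialTraining

variable {d n : ℕ} {p : ℝ≥0∞} {r η : ℝ} {S : Fin n → (Fin d → ℝ) × ℝ} {w : ℕ → Fin d → ℝ}

theorem dotProduct_eq_inner_toLp (v x : Fin d → ℝ) :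
    v ⬝ᵥ x = ⟪WithLp.toLp 2 v, WithLp.toLp 2 x⟫_ℝ := by
  simp [PiLp.inner_apply, dotProduct, mul_comm]

theorem empiricalMarginError_le_two_mul_expect_crossEntropy {x : Fin n → Fin d → ℝ}
    {v : Fin d → ℝ}
    (hx : ∀ i, crossEntropy ((S i).2 * (v ⬝ᵥ (S i).1)) ≤ crossEntropy ((S i).2 * (v ⬝ᵥ x i))) :
    empiricalMarginError S v 0 ≤ 2 * 𝔼 i, crossEntropy ((S i).2 * (v ⬝ᵥ x i)) := by
  rw [empiricalMarginError, Finset.mul_expect]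
  refine Finset.expect_le_expect fun i _ => ?_
  split_ifs with hi
  · linarith [half_le_crossEntropy hi, hx i]
  · exact mul_nonneg zero_le_two (crossEntropy_nonneg _)

theorem IsAdversarialTraining.exists_empiricalMarginError_le
    (hw : IsAdversarialTraining p r η S w) (hw0 : w 0 = 0) (hp : p ≠ 0) (hr : 0 ≤ r) {H ε b : ℝ}
    (hη : 0 < η) (hηH : η * H ^ 2 ≤ 1) (hε : 0 < ε) (hyS : ∀ i, (S i).2 = 1 ∨ (S i).2 = -1)
    (hxS : ∀ i δ, vecNorm p δ ≤ r → vecNorm 2 ((S i).1 + δ) ≤ H) {u : Fin d → ℝ}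
    (hu : ∀ δ : Fin n → Fin d → ℝ, (∀ i, vecNorm p (δ i) ≤ r) →
      𝔼 i, crossEntropy ((S i).2 * (u ⬝ᵥ ((S i).1 + δ i))) ≤ b) :
    ∃ k : ℕ, k ≤ u ⬝ᵥ u / (η * ε) ∧ empiricalMarginError S (w k) 0 ≤ 2 * (2 * b + ε) := by
  obtain ⟨δ, hδ, hstep⟩ := hw
  let y : Fin n → ℝ := fun i => (S i).2
  let x : ℕ → Fin n → EuclideanSpace ℝ (Fin d) := fun k i => WithLp.toLp 2 ((S i).1 + δ k i)
  have hy (i : Fin n) : |y i| = 1 := by rcases hyS i with h | h <;> simp [y, h]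
  have hrisk (k : ℕ) (v : Fin d → ℝ) : crossEntropyRisk y (x k) (WithLp.toLp 2 v) =
      𝔼 i, crossEntropy ((S i).2 * (v ⬝ᵥ ((S i).1 + δ k i))) := by
    simp only [crossEntropyRisk, dotProduct_eq_inner_toLp, y, x]
  have hdescent (k : ℕ) : WithLp.toLp 2 (w (k + 1)) = WithLp.toLp 2 (w k) -
      η • crossEntropyRiskGradient y (x k) (WithLp.toLp 2 (w k)) := by
    rw [hstep k]
    ext j
    simp [crossEntropyRiskGradient, dotProduct_eq_inner_toLp, y, x, div_eq_mul_inv, mul_assoc,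
      inner_add_right]
  have hinner (k : ℕ) : crossEntropyRisk y (x k) (WithLp.toLp 2 (w k)) - b ≤
      ⟪crossEntropyRiskGradient y (x k) (WithLp.toLp 2 (w k)),
        WithLp.toLp 2 (w k) - WithLp.toLp 2 u⟫_ℝ := by
    refine le_trans ?_ (crossEntropyRisk_sub_le_inner y (x k) _ _)
    rw [hrisk k u]
    exact sub_le_sub_left (hu _ fun i => (hδ k i).1) _
  obtain ⟨k, hk, hloss⟩ := exists_le_of_gradient_steps hη hηH hε (by simp [hw0]) hdescent
    (fun k => crossEntropyRisk_nonneg y (x k) _)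
    (fun k => norm_crossEntropyRiskGradient_sq_le hy (fun i => hxS i _ (hδ k i).1) _) hinner
  refine ⟨k, ?_, ?_⟩
  · rwa [dotProduct_self_eq_vecNorm_sq]
  · rw [hrisk] at hloss
    refine (empiricalMarginError_le_two_mul_expect_crossEntropy fun i => ?_).trans (by gcongr)
    simpa using (hδ k i).2 0 (by simpa [vecNorm_eq_toReal_eLpNorm hp] using hr)

end AdversarialTraining

section NormRatio

variable {d : ℕ} {p : ℝ≥0∞}

/-- The largest possible value of `‖x‖_2 / ‖x‖_p` for `x` in `ℝ^d`, when `2 ≤ p`. The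
dependence of the rates on `d` and `p` is through this number. -/
noncomputable def normRatio (d : ℕ) (p : ℝ≥0∞) : ℝ := (d : ℝ) ^ (1 / 2 - p⁻¹.toReal)

theorem vecNorm_two_le_normRatio_mul (hp : 2 ≤ p) (x : Fin d → ℝ) :
    vecNorm 2 x ≤ normRatio d p * vecNorm p x := by
  simpa [normRatio] using vecNorm_le_rpow_mul_vecNorm two_ne_zero hp x

theorem vecNorm_two_le_normRatio (hp : 2 ≤ p) {x : Fin d → ℝ} (hx : vecNorm p x ≤ 1) :
    vecNorm 2 x ≤ normRatio d p :=
  (vecNorm_two_le_normRatio_mul hp x).trans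
    (mul_le_of_le_one_right (Real.rpow_nonneg d.cast_nonneg _) hx)

theorem toReal_inv_le_half (hp : 2 ≤ p) : p⁻¹.toReal ≤ 1 / 2 := by
  simpa using ENNReal.toReal_mono (by simp) (ENNReal.inv_le_inv.2 hp)

theorem one_le_normRatio (hd : 1 ≤ d) (hp : 2 ≤ p) : 1 ≤ normRatio d p :=
  Real.one_le_rpow (mod_cast hd) (sub_nonneg.2 (toReal_inv_le_half hp))

theorem normRatio_sq (d : ℕ) (p : ℝ≥0∞) : normRatio d p ^ 2 = (d : ℝ) ^ (1 - 2 * p⁻¹.toReal) := by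
  rw [normRatio, ← Real.rpow_mul_natCast d.cast_nonneg]
  ring_nf

theorem abs_dotProduct_le_of_unit {v x : Fin d → ℝ} (hv : v ⬝ᵥ v = 1) : |v ⬝ᵥ x| ≤ vecNorm 2 x := by
  have hv1 : vecNorm 2 v = 1 := by
    rw [← pow_eq_one_iff_of_nonneg (vecNorm_nonneg one_le_two v) two_ne_zero,
      ← dotProduct_self_eq_vecNorm_sq, hv]
  simpa [hv1] using abs_dotProduct_le_vecNorm_mul v x

theorem abs_dotProduct_le_normRatio_mul (hp : 2 ≤ p) {v x : Fin d → ℝ} {r : ℝ} (hv : v ⬝ᵥ v = 1)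
    (hx : vecNorm p x ≤ r) : |v ⬝ᵥ x| ≤ normRatio d p * r :=
  ((abs_dotProduct_le_of_unit hv).trans (vecNorm_two_le_normRatio_mul hp x)).trans
    (mul_le_mul_of_nonneg_left hx (Real.rpow_nonneg d.cast_nonneg _))

theorem vecNorm_two_add_le (hp : 2 ≤ p) {x δ : Fin d → ℝ} (hx : vecNorm p x ≤ 1)
    (hδ : vecNorm p δ ≤ 1) : vecNorm 2 (x + δ) ≤ 2 * normRatio d p :=
  calc vecNorm 2 (x + δ) ≤ vecNorm 2 x + vecNorm 2 δ :=
        norm_add_le (WithLp.toLp 2 x) (WithLp.toLp 2 δ)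
    _ ≤ 2 * normRatio d p := by
        linarith [vecNorm_two_le_normRatio hp hx, vecNorm_two_le_normRatio hp hδ]

end NormRatio

section Training

variable {d n : ℕ} {p : ℝ≥0∞} {r η κ M ε A t b : ℝ} {v : Fin d → ℝ}

theorem IsAdversarialTraining.exists_empiricalMarginError_le_of_competitorLoss
    {S : Fin n → (Fin d → ℝ) × ℝ} {w : ℕ → Fin d → ℝ} (hw : IsAdversarialTraining p r η S w)
    (hw0 : w 0 = 0) (hp : 2 ≤ p) (hr : 0 ≤ r) (hr1 : r ≤ 1) (hη : 0 < η)
    (hηB : η * (2 * normRatio d p) ^ 2 ≤ 1) (hε : 0 < ε) (hκ : normRatio d p * r ≤ κ * ε)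
    (hM : 2 * normRatio d p ≤ M * ε) (hyS : ∀ i, (S i).2 = 1 ∨ (S i).2 = -1)
    (hxS : ∀ i, vecNorm p (S i).1 ≤ 1) (hv : v ⬝ᵥ v = 1)
    (hb : 𝔼 i, competitorLoss v ε κ M (S i) ≤ b) :
    ∃ k : ℕ, k ≤ (η * ε ^ 3)⁻¹ ∧ empiricalMarginError S (w k) 0 ≤ 2 * (2 * b + ε) := by
  have hshift (i : Fin n) (δ : Fin d → ℝ) (hδ : vecNorm p δ ≤ r) :
      vecNorm 2 ((S i).1 + δ) ≤ 2 * normRatio d p := vecNorm_two_add_le hp (hxS i) (hδ.trans hr1)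
  obtain ⟨k, hk, hemp⟩ := hw.exists_empiricalMarginError_le hw0 (two_pos.trans_le hp).ne' hr hη
    hηB hε hyS hshift (u := ε⁻¹ • v) (b := b) fun δ hδ =>
      (Finset.expect_le_expect fun i _ => crossEntropy_le_competitorLoss hε (hyS i)
        ((abs_dotProduct_le_normRatio_mul hp hv (hδ i)).trans hκ)
        ((abs_dotProduct_le_of_unit hv).trans ((hshift i _ (hδ i)).trans hM))).trans hb
  refine ⟨k, hk.trans_eq ?_, hemp⟩
  rw [smul_dotProduct, dotProduct_smul, hv]
  simp only [smul_eq_mul]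
  field_simp

/-- The samples on which some run of adversarial training has no iterate of robust error at most `E`
within `T` steps. -/
def trainingFailure (D : Measure ((Fin d → ℝ) × ℝ)) (p : ℝ≥0∞) (r η T E : ℝ) (n : ℕ) :
    Set (Fin n → (Fin d → ℝ) × ℝ) :=
  {S | ¬ ∀ w : ℕ → Fin d → ℝ, IsAdversarialTraining p r η S w → w 0 = 0 →
    ∃ k : ℕ, (k : ℝ) ≤ T ∧ robustError D p r (w k) ≤ E}

theorem ae_pi_forall {α : Type*} [MeasurableSpace α] {μ : Measure α} [IsProbabilityMeasure μ]
    {P : α → Prop} (h : ∀ᵐ a ∂μ, P a) (n : ℕ) :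
    ∀ᵐ S ∂Measure.pi fun _ : Fin n => μ, ∀ i, P (S i) :=
  ae_all_iff.2 fun _ => Measure.tendsto_eval_ae_ae.eventually h

variable {D : Measure ((Fin d → ℝ) × ℝ)}

theorem measure_pi_expect_competitorLoss_le [IsProbabilityMeasure D] (hε : 0 ≤ ε) (hM : 0 ≤ M)
    (hb : ∫ z, competitorLoss v ε κ M z ∂D ≤ b) (ht : 0 ≤ t) (n : ℕ) :
    Measure.pi (fun _ : Fin n => D) {S | b + t ≤ 𝔼 i, competitorLoss v ε κ M (S i)} ≤
      ENNReal.ofReal (Real.exp (-(2 * n * t ^ 2 / (Real.exp κ + (1 + M)) ^ 2))) := by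
  have h := measure_pi_integral_add_le_expect D (measurable_competitorLoss v ε κ M)
    (competitorLoss_mem_Icc hε hM v κ) ht n
  rw [sub_zero] at h
  exact (measure_mono fun S hS => (add_le_add_left hb t).trans hS).trans h

theorem measure_trainingFailure_le [IsProbabilityMeasure D] {N : ℕ} (hp : 2 ≤ p) (hr : 0 ≤ r)
    (hr1 : r ≤ 1) (hη : 0 < η) (hηB : η * (2 * normRatio d p) ^ 2 ≤ 1) (hε : 0 < ε)
    (hκ : normRatio d p * r ≤ κ * ε) (hM : 2 * normRatio d p ≤ M * ε) (hN : 0 < N) (ht : 0 ≤ t)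
    (hA : 0 ≤ A) (hy : ∀ᵐ z ∂D, z.2 = 1 ∨ z.2 = -1) (hx : ∀ᵐ z ∂D, vecNorm p z.1 ≤ 1)
    (hdens : ∀ v : Fin d → ℝ, v ⬝ᵥ v = 1 →
      D.map (fun z => v ⬝ᵥ z.1) ≤ ENNReal.ofReal A • volume)
    (hv : v ⬝ᵥ v = 1) (hb : ∫ z, competitorLoss v ε κ M z ∂D ≤ b) (n : ℕ) :
    Measure.pi (fun _ : Fin n => D) (trainingFailure D p r η (η * ε ^ 3)⁻¹
        (2 * (2 * (b + ε) + ε) + t + A * (2 * (2 * (d * (1 / N)) + normRatio d p * r))) n) ≤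
      ENNReal.ofReal ((2 * N + 1) ^ d * Real.exp (-(2 * n * t ^ 2))) +
        ENNReal.ofReal (Real.exp (-(2 * n * ε ^ 2 / (Real.exp κ + (1 + M)) ^ 2))) := by
  rcases n.eq_zero_or_pos with rfl | hn
  · refine prob_le_one.trans (le_add_left ?_)
    simp
  have : NeZero n := ⟨hn.ne'⟩
  have hB : 0 ≤ normRatio d p := Real.rpow_nonneg d.cast_nonneg _
  have hM0 : 0 ≤ M := nonneg_of_mul_nonneg_left ((by positivity : (0 : ℝ) ≤ _).trans hM) hε
  have hp1 : 1 ≤ p := one_le_two.trans hp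
  have hgrid := measure_pi_exists_empiricalMarginError_add_le (D := D) (gridVector (d := d) N)
    (-(d * (1 / N))) ht n
  simp only [Fintype.card_pi, Fintype.card_fin, Finset.prod_const, Finset.card_univ] at hgrid
  push_cast at hgrid
  refine le_trans ?_ ((measure_union_le _ _).trans (add_le_add hgrid
    (measure_pi_expect_competitorLoss_le hε.le hM0 hb hε.le n)))
  refine measure_mono_ae ?_
  filter_upwards [ae_pi_forall hy n, ae_pi_forall hx n] with S hyS hxS hfail
  by_contra hgood
  obtain ⟨hgridS, hcompS⟩ := not_or.1 hgood
  refine hfail fun w hw hw0 => ?_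
  obtain ⟨k, hk, hemp⟩ := hw.exists_empiricalMarginError_le_of_competitorLoss hw0 hp hr hr1 hη hηB
    hε hκ hM hyS hxS hv (not_le.1 hcompS).le
  refine ⟨k, hk, (robustError_le_empiricalMarginError_add hN (by positivity) hA ht
    (fun v δ hv hδ => abs_dotProduct_le_normRatio_mul hp hv hδ) hy
    (hx.mono fun z hz i => (abs_apply_le_vecNorm hp1 z.1 i).trans hz) hdens hyS
    (fun i l => (abs_apply_le_vecNorm hp1 _ l).trans (hxS i))
    (fun j => not_le.1 fun hj => hgridS ⟨j, hj⟩) (w k)).trans ?_⟩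
  gcongr

end Training

section SampleSize

theorem exp_neg_log_div_le_half {d o δ : ℝ} (hd : 2 ≤ d) (ho : 0 < o) (ho1 : o ≤ 1) (hδ : 0 < δ) :
    Real.exp (-Real.log (d / (o * δ))) ≤ δ / 2 := by
  rw [Real.exp_neg, Real.exp_log (by positivity), inv_div]
  exact div_le_div₀ hδ.le (mul_le_of_le_one_left hδ.le ho1) two_pos hd

theorem two_mul_ceil_add_one_le_pow {a : ℝ} (ha : 2 ≤ a) : (2 * ⌈a⌉₊ + 1 : ℝ) ≤ a ^ 4 := by
  have hpow : 2 ^ 3 * a ≤ a ^ 3 * a := by gcongr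
  linarith [Nat.ceil_lt_add_one (zero_le_two.trans ha)]

theorem pow_mul_exp_neg_le {d : ℕ} {x L B C C₁ s : ℝ} (hx : 0 ≤ x) (hxL : x ≤ Real.exp L ^ 4)
    (hL : 0 ≤ L) (hB : 1 ≤ B) (hdB : d ≤ C₁ * B ^ 2) (hC : 4 * C₁ + 1 ≤ 2 * C)
    (hs : C * L * B ^ 2 ≤ s) : x ^ d * Real.exp (-(2 * s)) ≤ Real.exp (-L) := by
  have hexponent : d * (4 * L) + L ≤ 2 * s := by
    have hgrid : d * (4 * L) ≤ C₁ * B ^ 2 * (4 * L) := by gcongr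
    have hL_le : L ≤ L * B ^ 2 := le_mul_of_one_le_right hL (one_le_pow₀ hB)
    have hsum : (4 * C₁ + 1) * (L * B ^ 2) ≤ 2 * C * (L * B ^ 2) := by gcongr
    linarith
  calc x ^ d * Real.exp (-(2 * s)) ≤ (Real.exp L ^ 4) ^ d * Real.exp (-(2 * s)) := by gcongr
    _ = Real.exp (d * (4 * L) - 2 * s) := by
        rw [← Real.exp_nat_mul, ← Real.exp_nat_mul, ← Real.exp_add, sub_eq_add_neg]
        push_cast
        rfl
    _ ≤ Real.exp (-L) := Real.exp_le_exp.2 (by linarith)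

theorem le_two_mul_sq_div_sq {L B C κ ε o n : ℝ} (hε : 0 < ε) (hε1 : ε ≤ 1) (hB : 1 ≤ B)
    (ho : 0 ≤ o) (hoε : o ≤ ε ^ 2) (hn : 0 ≤ n) (hL : 0 ≤ L)
    (hC : (Real.exp κ + 3) ^ 2 ≤ 2 * C) (hs : C * L * B ^ 2 ≤ n * o ^ 2) :
    L ≤ 2 * n * ε ^ 2 / (Real.exp κ + (1 + 2 * B / ε)) ^ 2 := by
  have hexp := Real.exp_pos κ
  have hratio : 1 ≤ B / ε := (one_le_div hε).2 (hε1.trans hB)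
  have hrange : Real.exp κ + (1 + 2 * B / ε) ≤ (Real.exp κ + 3) * (B / ε) := by
    rw [mul_div_assoc]
    nlinarith
  rw [le_div_iff₀ (by positivity)]
  calc L * (Real.exp κ + (1 + 2 * B / ε)) ^ 2 ≤ L * ((Real.exp κ + 3) * (B / ε)) ^ 2 := by gcongr
    _ = (Real.exp κ + 3) ^ 2 * (L * (B / ε) ^ 2) := by ring
    _ ≤ 2 * C * (L * (B / ε) ^ 2) := by gcongr
    _ = 2 * (C * L * B ^ 2) / ε ^ 2 := by ring
    _ ≤ 2 * (n * o ^ 2) / ε ^ 2 := by gcongr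
    _ ≤ 2 * (n * (ε ^ 2) ^ 2) / ε ^ 2 := by gcongr
    _ = 2 * n * ε ^ 2 := by field_simp

theorem mul_one_div_ceil_div_le {d o : ℝ} (hd : 0 < d) (ho : 0 < o) : d * (1 / ⌈d / o⌉₊) ≤ o := by
  rw [mul_one_div]
  exact (div_le_comm₀ (mod_cast Nat.ceil_pos.2 (by positivity)) ho).2 (Nat.le_ceil _)

theorem div_le_exp_log_div_mul {d o δ : ℝ} (hd : 0 < d) (ho : 0 < o) (hδ : 0 < δ) (hδ1 : δ ≤ 1) :
    d / o ≤ Real.exp (Real.log (d / (o * δ))) := by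
  rw [Real.exp_log (by positivity)]
  gcongr
  exact mul_le_of_le_one_right ho.le hδ1

theorem mul_le_mul_sqrt_mul {B o κ r : ℝ} (hB : 0 ≤ B) (ho : 0 ≤ o) (hBo : B * o ≤ 1) (hκ : 0 ≤ κ)
    (hr : r ≤ κ * o) : B * r ≤ κ * √(B * o) := by
  calc B * r ≤ B * (κ * o) := by gcongr
    _ = κ * (B * o) := by ring
    _ ≤ κ * √(B * o) := by
      gcongr
      exact Real.le_sqrt_of_sq_le (pow_le_of_le_one (by positivity) hBo two_ne_zero)

end SampleSize

section OptimalError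

variable {d n : ℕ} {D : Measure ((Fin d → ℝ) × ℝ)} {p : ℝ≥0∞} {r η κ A o : ℝ} {v : Fin d → ℝ}

theorem trainingFailure_subset {T E E' : ℝ} (hE : E' ≤ E) :
    trainingFailure D p r η T E n ⊆ trainingFailure D p r η T E' n := fun _ hS hgood =>
  hS fun w hw hw0 => (hgood w hw hw0).imp fun _ hk => ⟨hk.1, hk.2.trans hE⟩

theorem trainingFailure_eq_empty [IsProbabilityMeasure D] {T E : ℝ} (hT : 0 ≤ T) (hE : 1 ≤ E) :
    trainingFailure D p r η T E n = ∅ :=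
  Set.eq_empty_of_forall_notMem fun _ hS =>
    hS fun _ _ _ => ⟨0, by simpa using hT, measureReal_le_one.trans hE⟩

theorem integral_competitorLoss_sqrt_le [IsFiniteMeasure D] {B : ℝ} (hB : 1 ≤ B) (ho : 0 < o)
    (hBo : B * o ≤ 1) (hA : 0 ≤ A)
    (hdens : D.map (fun z => v ⬝ᵥ z.1) ≤ ENNReal.ofReal A • volume)
    (hvo : marginError D v 0 ≤ 2 * o) :
    ∫ z, competitorLoss v √(B * o) κ (2 * B / √(B * o)) z ∂D ≤
      (2 * A * Real.exp κ + 6) * √(B * o) := by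
  have hε : 0 < √(B * o) := Real.sqrt_pos.2 (by positivity)
  have hoε : o ≤ √(B * o) := Real.le_sqrt_of_sq_le (by nlinarith)
  have hmargin : (1 + 2 * B / √(B * o)) * (2 * o) = 2 * o + 4 * √(B * o) := by
    field_simp
    linear_combination -4 * Real.mul_self_sqrt (by positivity : 0 ≤ B * o)
  calc ∫ z, competitorLoss v √(B * o) κ (2 * B / √(B * o)) z ∂D
      ≤ Real.exp κ * (A * (2 * √(B * o))) + (1 + 2 * B / √(B * o)) * marginError D v 0 :=
        integral_competitorLoss_le hA hdens hε _ _
    _ ≤ Real.exp κ * (A * (2 * √(B * o))) + (1 + 2 * B / √(B * o)) * (2 * o) := by gcongr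
    _ ≤ (2 * A * Real.exp κ + 6) * √(B * o) := by
        rw [hmargin]
        linarith

theorem measure_trainingFailure_le_of_sample_size [IsProbabilityMeasure D] {δ C C₁ : ℝ}
    (hd : 2 ≤ d) (hp : 2 ≤ p) (hr : 0 ≤ r) (hr1 : r ≤ 1) (hη : 0 < η)
    (hηB : η * (2 * normRatio d p) ^ 2 ≤ 1) (ho : 0 < o) (hBo : normRatio d p * o ≤ 1)
    (hκ : 0 ≤ κ) (hrκ : r ≤ κ * o) (hA : 0 ≤ A) (hy : ∀ᵐ z ∂D, z.2 = 1 ∨ z.2 = -1)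
    (hx : ∀ᵐ z ∂D, vecNorm p z.1 ≤ 1)
    (hdens : ∀ v : Fin d → ℝ, v ⬝ᵥ v = 1 →
      D.map (fun z => v ⬝ᵥ z.1) ≤ ENNReal.ofReal A • volume)
    (hv : v ⬝ᵥ v = 1) (hvo : marginError D v 0 ≤ 2 * o) (hδ : 0 < δ) (hδ1 : δ ≤ 1)
    (hdB : d ≤ C₁ * normRatio d p ^ 2) (hC₁ : 4 * C₁ + 1 ≤ 2 * C)
    (hC : (Real.exp κ + 3) ^ 2 ≤ 2 * C)
    (hn : C * Real.log (d / (o * δ)) * normRatio d p ^ 2 ≤ n * o ^ 2) :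
    Measure.pi (fun _ : Fin n => D) (trainingFailure D p r η (η * √(normRatio d p * o) ^ 3)⁻¹
        ((8 * A * Real.exp κ + 2 * A * (2 + κ) + 31) * √(normRatio d p * o)) n) ≤
      ENNReal.ofReal δ := by
  have hd' : (2 : ℝ) ≤ d := mod_cast hd
  set B := normRatio d p
  have hB : 1 ≤ B := one_le_normRatio (by omega) hp
  set ε := √(B * o)
  have hε : 0 < ε := Real.sqrt_pos.2 (by positivity)
  have hε1 : ε ≤ 1 := Real.sqrt_le_one.2 hBo
  have hε2 : ε ^ 2 = B * o := Real.sq_sqrt (by positivity)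
  have hoε2 : o ≤ ε ^ 2 := hε2 ▸ le_mul_of_one_le_left ho.le hB
  have hoε : o ≤ ε := hoε2.trans (pow_le_of_le_one hε.le hε1 two_ne_zero)
  have ho1 : o ≤ 1 := hoε.trans hε1
  have hdo : 2 ≤ d / o := hd'.trans (le_div_self (by positivity) ho ho1)
  have hBr : B * r ≤ κ * ε := mul_le_mul_sqrt_mul (by positivity) ho.le hBo hκ hrκ
  have hexpL : d / o ≤ Real.exp (Real.log (d / (o * δ))) :=
    div_le_exp_log_div_mul (by positivity) ho hδ hδ1
  set N := ⌈d / o⌉₊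
  set L := Real.log (d / (o * δ))
  have hN : 0 < N := Nat.ceil_pos.2 (by positivity)
  have hL0 : 0 ≤ L := Real.one_le_exp_iff.1 (by linarith)
  have hδL : Real.exp (-L) ≤ δ / 2 := exp_neg_log_div_le_half hd' ho ho1 hδ
  have hM : 2 * B ≤ 2 * B / ε * ε := by rw [div_mul_cancel₀ _ hε.ne']
  refine (measure_mono (trainingFailure_subset ?_)).trans
    ((measure_trainingFailure_le hp hr hr1 hη hηB hε hBr hM hN ho.le hA hy hx hdens hv
      (integral_competitorLoss_sqrt_le hB ho hBo hA (hdens v hv) hvo) n).trans ?_)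
  · have hslab : A * (2 * (2 * (d * (1 / N)) + B * r)) ≤ A * (2 * (2 * ε + κ * ε)) := by
      gcongr
      exact (mul_one_div_ceil_div_le (by positivity) ho).trans hoε
    linarith
  · rw [← ENNReal.ofReal_add (by positivity) (Real.exp_pos _).le]
    refine ENNReal.ofReal_le_ofReal ((add_le_add ?_ ?_).trans_eq (add_halves δ))
    · rw [mul_assoc]
      refine le_trans (pow_mul_exp_neg_le (by positivity) ?_ hL0 hB hdB hC₁ hn) hδL
      exact (two_mul_ceil_add_one_le_pow hdo).trans (by gcongr)
    · refine le_trans (Real.exp_le_exp.2 (neg_le_neg ?_)) hδL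
      exact le_two_mul_sq_div_sq hε hε1 hB ho.le hoε2 n.cast_nonneg hL0 hC hn

end OptimalError

section Concentration

variable {d : ℕ} {D : Measure ((Fin d → ℝ) × ℝ)} {p q : ℝ≥0∞} {r U U' R : ℝ}

theorem ae_fst_vecNorm_le (hp : 1 ≤ p) (hx : ∀ᵐ z ∂D, vecNorm p z.1 ≤ 1) :
    ∀ᵐ x ∂D.fst, vecNorm p x ≤ 1 := by
  have : Fact (1 ≤ p) := ⟨hp⟩
  have hcont : Continuous fun x : Fin d → ℝ => vecNorm p x := (PiLp.continuous_toLp p _).norm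
  exact (ae_map_iff measurable_fst.aemeasurable
    (measurableSet_le hcont.measurable measurable_const)).2 hx

theorem AntiConcentrated.map_dotProduct_fst_le (hA : AntiConcentrated D.fst U) (hd : 2 ≤ d)
    (hp : 1 ≤ p) (hx : ∀ᵐ z ∂D, vecNorm p z.1 ≤ 1) {v : Fin d → ℝ} (hv : v ⬝ᵥ v = 1) :
    D.map (fun z => v ⬝ᵥ z.1) ≤ ENNReal.ofReal (3 * U) • volume := by
  have h := hA.map_dotProduct_le hd ((ae_fst_vecNorm_le hp hx).mono fun x hx i =>
    (abs_apply_le_vecNorm hp x i).trans hx) hv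
  rwa [Measure.fst, Measure.map_map (measurable_dotProduct v) measurable_fst] at h

theorem AntiAntiConcentrated.dim_le_normRatio_sq [IsProbabilityMeasure D]
    (hA : AntiAntiConcentrated D.fst U' R) (hU' : 0 < U') (hR : 0 < R) (hd : 2 ≤ d) (hp : 2 ≤ p)
    (hx : ∀ᵐ z ∂D, vecNorm p z.1 ≤ 1) : d ≤ 128 * U' / R ^ 4 * normRatio d p ^ 2 :=
  hA.dim_le hU' hR hd ((ae_fst_vecNorm_le (one_le_two.trans hp) hx).mono fun _ =>
    vecNorm_two_le_normRatio hp)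

theorem AntiAntiConcentrated.min_le_mul_robustOpt [IsFiniteMeasure D]
    (hA : AntiAntiConcentrated D.fst U' R) (hU' : 0 < U') (hR : 0 < R) (hd : 2 ≤ d) (hp : 2 ≤ p)
    (hq : q ≠ 0) (hr : 0 ≤ r) (hy : ∀ᵐ z ∂D, z.2 = 1 ∨ z.2 = -1) (ho : 0 < robustOpt D p q r) :
    min r R ≤ 2 * U' / R * robustOpt D p q r := by
  have h := le_robustOpt hq ho fun w hw => hA.le_robustError hU' hR.le hd hp hr hy hw
  rw [div_le_iff₀ (by positivity), ← le_div_iff₀ hR] at h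
  exact h.trans_eq (by ring)

end Concentration

section HighProbability

variable {d n : ℕ} {D : Measure ((Fin d → ℝ) × ℝ)} {p q : ℝ≥0∞} {r U U' R η δ : ℝ}

theorem measure_trainingFailure_le_of_concentration [IsProbabilityMeasure D] {κ C C₁ : ℝ}
    (hd : 2 ≤ d) (hp : 2 ≤ p) (hq : q ≠ 0) (hr : 0 ≤ r) (hr1 : r ≤ 1)
    (hy : ∀ᵐ z ∂D, z.2 = 1 ∨ z.2 = -1) (hx : ∀ᵐ z ∂D, vecNorm p z.1 ≤ 1)
    (hA : AntiConcentrated D.fst U) (hU : 0 ≤ U) (ho : 0 < robustOpt D p q r)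
    (hBo : normRatio d p * robustOpt D p q r ≤ 1) (hη : 0 < η)
    (hηB : η * (2 * normRatio d p) ^ 2 ≤ 1) (hκ : 0 ≤ κ) (hrκ : r ≤ κ * robustOpt D p q r)
    (hδ : 0 < δ) (hδ1 : δ ≤ 1) (hdB : d ≤ C₁ * normRatio d p ^ 2) (hC₁ : 4 * C₁ + 1 ≤ 2 * C)
    (hC : (Real.exp κ + 3) ^ 2 ≤ 2 * C)
    (hn : C * Real.log (d / (robustOpt D p q r * δ)) *
      (normRatio d p ^ 2 / robustOpt D p q r ^ 2) ≤ n) :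
    Measure.pi (fun _ : Fin n => D)
      (trainingFailure D p r η (η * √(normRatio d p * robustOpt D p q r) ^ 3)⁻¹
        ((24 * U * Real.exp κ + 6 * U * (2 + κ) + 31) * √(normRatio d p * robustOpt D p q r)) n) ≤
      ENNReal.ofReal δ := by
  have hp1 : 1 ≤ p := one_le_two.trans hp
  obtain ⟨v, hv, hvo⟩ := exists_robustError_lt_two_mul_robustOpt hq ho
  have hmargin : marginError D v 0 ≤ 2 * robustOpt D p q r :=
    (marginError_zero_le_robustError (two_pos.trans_le hp).ne' hr hy v).trans hvo.le
  rw [← mul_div_assoc, div_le_iff₀ (by positivity)] at hn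
  convert measure_trainingFailure_le_of_sample_size hd hp hr hr1 hη hηB ho hBo hκ hrκ
    (by positivity : 0 ≤ 3 * U) hy hx (fun v hv => hA.map_dotProduct_fst_le hd hp1 hx hv) hv hmargin
    hδ hδ1 hdB hC₁ hC hn using 3
  ring

theorem mul_lt_one_of_mul_sqrt_lt_one {C x : ℝ} (hC : 1 ≤ C) (hx : 0 ≤ x) (h : C * √x < 1) :
    C * x < 1 := by
  have hsqrt : √x ≤ 1 := (le_mul_of_one_le_left (Real.sqrt_nonneg x) hC).trans h.le
  have hle : x ≤ √x := Real.le_sqrt_of_sq_le (pow_le_of_le_one hx (Real.sqrt_le_one.1 hsqrt)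
    two_ne_zero)
  exact (mul_le_mul_of_nonneg_left hle (by positivity)).trans_lt h

theorem measure_trainingFailure_le_of_anti_anti_concentration [IsProbabilityMeasure D] {C : ℝ}
    (hd : 2 ≤ d) (hp : 2 ≤ p) (hq : q ≠ 0) (hr : 0 ≤ r) (hy : ∀ᵐ z ∂D, z.2 = 1 ∨ z.2 = -1)
    (hx : ∀ᵐ z ∂D, vecNorm p z.1 ≤ 1) (hA : AntiConcentrated D.fst U) (hU : 0 ≤ U)
    (hAA : AntiAntiConcentrated D.fst U' R) (hU' : 0 < U') (hR : 0 < R)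
    (ho : 0 < robustOpt D p q r) (hη : 0 < η) (hηB : η * (2 * normRatio d p) ^ 2 ≤ 1)
    (hδ : 0 < δ) (hδ1 : δ ≤ 1) (hC1 : 1 ≤ C) (hκ : 2 * U' / R ≤ C * min 1 R)
    (hE : 24 * U * Real.exp (2 * U' / R) + 6 * U * (2 + 2 * U' / R) + 31 ≤ C)
    (hC₁ : 4 * (128 * U' / R ^ 4) + 1 ≤ 2 * C) (hC : (Real.exp (2 * U' / R) + 3) ^ 2 ≤ 2 * C)
    (hn : C * Real.log (d / (robustOpt D p q r * δ)) *
      (normRatio d p ^ 2 / robustOpt D p q r ^ 2) ≤ n) :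
    Measure.pi (fun _ : Fin n => D)
      (trainingFailure D p r η (η * √(normRatio d p * robustOpt D p q r) ^ 3)⁻¹
        (C * √(normRatio d p * robustOpt D p q r)) n) ≤ ENNReal.ofReal δ := by
  have hB : 1 ≤ normRatio d p := one_le_normRatio (by omega) hp
  rcases le_or_gt 1 (C * √(normRatio d p * robustOpt D p q r)) with htrivial | hsmall
  · rw [trainingFailure_eq_empty (by positivity) htrivial, measure_empty]
    exact zero_le
  have hCBo : C * (normRatio d p * robustOpt D p q r) < 1 :=
    mul_lt_one_of_mul_sqrt_lt_one hC1 (by positivity) hsmall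
  have hBo : normRatio d p * robustOpt D p q r ≤ 1 :=
    (le_mul_of_one_le_left (by positivity) hC1).trans hCBo.le
  have hκo : 2 * U' / R * robustOpt D p q r < min 1 R := by
    calc 2 * U' / R * robustOpt D p q r
        ≤ C * min 1 R * (normRatio d p * robustOpt D p q r) := by
          gcongr
          exact le_mul_of_one_le_left ho.le hB
      _ = C * (normRatio d p * robustOpt D p q r) * min 1 R := by ring
      _ < min 1 R := mul_lt_of_lt_one_left (by positivity) hCBo
  have hrκ : r ≤ 2 * U' / R * robustOpt D p q r :=
    (min_le_iff.1 (hAA.min_le_mul_robustOpt hU' hR hd hp hq hr hy ho)).resolve_right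
      (hκo.trans_le (min_le_right 1 R)).not_ge
  have hr1 : r ≤ 1 := (hrκ.trans hκo.le).trans (min_le_left 1 R)
  exact (measure_mono (trainingFailure_subset (by gcongr))).trans
    (measure_trainingFailure_le_of_concentration hd hp hq hr hr1 hy hx hA hU ho hBo hη hηB
      (by positivity) hrκ hδ hδ1 (hAA.dim_le_normRatio_sq hU' hR hd hp hx) hC₁ hC hn)

end HighProbability

section Rates

variable {d : ℕ} {p : ℝ≥0∞} {o η : ℝ}

theorem half_le_log_div (hd : 2 ≤ d) (ho : 0 < o) (ho1 : o ≤ 1) : 1 / 2 ≤ Real.log (d / o) := by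
  have hdo : (2 : ℝ) ≤ d / o :=
    (le_div_self two_pos.le ho ho1).trans (by gcongr; exact_mod_cast hd)
  linarith [Real.log_le_log two_pos hdo, Real.log_two_gt_d9]

theorem mul_two_mul_normRatio_sq_le_one (hd : 1 ≤ d) (hp : 2 ≤ p) (hη : 0 ≤ η) (ho1 : o ≤ 1)
    (hηo : η ≤ o / (4 * if p ≤ 2 then 4 else 4 * (d : ℝ))) :
    η * (2 * normRatio d p) ^ 2 ≤ 1 := by
  have hd1 : (1 : ℝ) ≤ d := mod_cast hd
  have hH : (2 * normRatio d p) ^ 2 ≤ 4 * if p ≤ 2 then 4 else 4 * (d : ℝ) := by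
    rw [mul_pow, normRatio_sq]
    split_ifs with h
    · rw [le_antisymm h hp]
      norm_num
    · have hexp := Real.rpow_le_rpow_of_exponent_le hd1
        (sub_le_self 1 (by positivity : 0 ≤ 2 * p⁻¹.toReal))
      rw [Real.rpow_one] at hexp
      linarith
  have hH0 : 0 < 4 * if p ≤ 2 then 4 else 4 * (d : ℝ) := by split_ifs <;> positivity
  calc η * (2 * normRatio d p) ^ 2 ≤ η * (4 * if p ≤ 2 then 4 else 4 * (d : ℝ)) := by gcongr
    _ ≤ o := (le_div_iff₀ hH0).1 hηo
    _ ≤ 1 := ho1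

theorem sqrt_normRatio_mul (d : ℕ) (p : ℝ≥0∞) (o : ℝ) :
    √(normRatio d p * o) = (d : ℝ) ^ (1 / 4 - 1 / 2 * p⁻¹.toReal) * √o := by
  have hd := d.cast_nonneg (α := ℝ)
  rw [normRatio, Real.sqrt_mul (by positivity), Real.sqrt_eq_rpow, ← Real.rpow_mul hd]
  ring_nf

theorem inv_mul_sqrt_normRatio_mul_pow_le (hη : 0 < η) (ho : 0 < o) (ho1 : o ≤ 1) :
    (η * √(normRatio d p * o) ^ 3)⁻¹ ≤
      η⁻¹ * (d : ℝ) ^ (3 / 2 * p⁻¹.toReal - 3 / 4) / o ^ 3 := by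
  have hd := d.cast_nonneg (α := ℝ)
  have hpow : ((d : ℝ) ^ (1 / 4 - 1 / 2 * p⁻¹.toReal)) ^ 3 =
      ((d : ℝ) ^ (3 / 2 * p⁻¹.toReal - 3 / 4))⁻¹ := by
    rw [← Real.rpow_mul_natCast hd, ← Real.rpow_neg hd]
    push_cast
    ring_nf
  have hoo : o ≤ √o := Real.le_sqrt_of_sq_le (pow_le_of_le_one ho.le ho1 two_ne_zero)
  rw [sqrt_normRatio_mul, mul_pow, hpow, mul_inv, mul_inv, inv_inv, ← mul_assoc, ← div_eq_mul_inv]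
  gcongr

theorem rates_of_le_sqrt {C k e : ℝ} (hd : 2 ≤ d) (hC : 1 ≤ C) (hη : 0 < η) (ho : 0 < o)
    (ho1 : o ≤ 1) (hk : k ≤ (η * √(normRatio d p * o) ^ 3)⁻¹)
    (he : e ≤ C * √(normRatio d p * o)) :
    k ≤ 2 * C * Real.log (d / o) ^ 1 *
        (η⁻¹ * (d : ℝ) ^ (3 / 2 * p⁻¹.toReal - 3 / 4) / o ^ 3) ∧
      e ≤ 2 * C * Real.log (d / o) ^ 1 *
        ((d : ℝ) ^ (1 / 4 - 1 / 2 * p⁻¹.toReal) * √o + (d : ℝ) ^ (1 / 2 - p⁻¹.toReal) * o) ∧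
      (p = 2 → e ≤ 2 * C * Real.log (d / o) ^ 1 * √o) ∧
      (p = ∞ → e ≤ 2 * C * Real.log (d / o) ^ 1 *
        ((d : ℝ) ^ (1 / 4 : ℝ) * √o + (d : ℝ) ^ (1 / 2 : ℝ) * o)) := by
  have hlog : C ≤ 2 * C * Real.log (d / o) ^ 1 := by
    rw [pow_one]
    nlinarith [half_le_log_div hd ho ho1]
  have he_log : e ≤ 2 * C * Real.log (d / o) ^ 1 *
      ((d : ℝ) ^ (1 / 4 - 1 / 2 * p⁻¹.toReal) * √o) := by
    rw [← sqrt_normRatio_mul]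
    exact he.trans (by gcongr)
  have he_add : e ≤ 2 * C * Real.log (d / o) ^ 1 *
      ((d : ℝ) ^ (1 / 4 - 1 / 2 * p⁻¹.toReal) * √o + (d : ℝ) ^ (1 / 2 - p⁻¹.toReal) * o) :=
    he_log.trans (mul_le_mul_of_nonneg_left (le_add_of_nonneg_right (by positivity)) (by linarith))
  refine ⟨?_, he_add, ?_, ?_⟩
  · exact (hk.trans (inv_mul_sqrt_normRatio_mul_pow_le hη ho ho1)).trans
      (le_mul_of_one_le_left (by positivity) (hC.trans hlog))
  · rintro rfl
    have hexp : 1 / 4 - 1 / 2 * (2⁻¹ : ℝ≥0∞).toReal = 0 := by norm_num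
    simpa only [hexp, Real.rpow_zero, one_mul] using he_log
  · rintro rfl
    simpa using he_add

theorem admissible_of_le_div {C δ n : ℝ} (hd : 2 ≤ d) (hp : 2 ≤ p) (hC : 0 ≤ C) (ho1 : o ≤ 1)
    (hη : 0 < η) (hηo : η ≤ o / (4 * if p ≤ 2 then 4 else 4 * (d : ℝ))) (hδ : 0 < δ) (hδ1 : δ ≤ 1)
    (hn : 2 * C * Real.log (d / (o * δ)) ^ 1 * ((d : ℝ) ^ (1 - 2 * p⁻¹.toReal) / o ^ 2) ≤ n) :
    0 < o ∧ η * (2 * normRatio d p) ^ 2 ≤ 1 ∧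
      C * Real.log (d / (o * δ)) * (normRatio d p ^ 2 / o ^ 2) ≤ n := by
  have ho : 0 < o := (div_pos_iff_of_pos_right (by split_ifs <;> positivity)).1 (hη.trans_le hηo)
  refine ⟨ho, mul_two_mul_normRatio_sq_le_one (by omega) hp hη.le ho1 hηo, le_trans ?_ hn⟩
  have hlog := half_le_log_div hd (mul_pos ho hδ) (mul_le_one₀ ho1 hδ.le hδ1)
  rw [pow_one, normRatio_sq]
  gcongr
  linarith

end Rates

end AdvHalfspace

theorem corollary2_general (U U' R : ℝ) (hU : 0 < U) (hU' : 0 < U') (hR : 0 < R) :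
    ∃ C : ℝ, 1 ≤ C ∧
      ∀ (d : ℕ) (_ : 2 ≤ d) (p q : ℝ≥0∞) (_ : 2 ≤ p) (_ : q ≠ 0) (r : ℝ) (_ : 0 ≤ r)
        (D : Measure ((Fin d → ℝ) × ℝ)) (_ : IsProbabilityMeasure D)
        (_ : ∀ᵐ z ∂D, z.2 = 1 ∨ z.2 = -1) (_ : ∀ᵐ z ∂D, vecNorm p z.1 ≤ 1)
        (_ : AntiConcentrated D.fst U) (_ : AntiAntiConcentrated D.fst U' R)
        (_ : 0 < robustOpt D p q r)
        (η : ℝ) (_ : 0 < η) (_ : η * (2 * normRatio d p) ^ 2 ≤ 1)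
        (δ : ℝ) (_ : 0 < δ) (_ : δ ≤ 1) (n : ℕ)
        (_ : C * Real.log (d / (robustOpt D p q r * δ)) *
          (normRatio d p ^ 2 / robustOpt D p q r ^ 2) ≤ n),
        Measure.pi (fun _ : Fin n => D)
          (trainingFailure D p r η (η * √(normRatio d p * robustOpt D p q r) ^ 3)⁻¹
            (C * √(normRatio d p * robustOpt D p q r)) n) ≤
          ENNReal.ofReal δ := by
  have hκ : 0 < 2 * U' / R / min 1 R := by positivity
  have hC₁ : 0 < 128 * U' / R ^ 4 := by positivity
  have hE : 0 < 24 * U * Real.exp (2 * U' / R) + 6 * U * (2 + 2 * U' / R) := by positivity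
  have hrange : 0 < (Real.exp (2 * U' / R) + 3) ^ 2 := by positivity
  refine ⟨24 * U * Real.exp (2 * U' / R) + 6 * U * (2 + 2 * U' / R) + 31 + 2 * U' / R / min 1 R +
    4 * (128 * U' / R ^ 4) + (Real.exp (2 * U' / R) + 3) ^ 2, by linarith, ?_⟩
  intro d hd p q hp hq r hr D _ hy hx hA hAA ho η hη hηB δ hδ hδ1 n hn
  exact measure_trainingFailure_le_of_anti_anti_concentration hd hp hq hr hy hx hA hU.le hAA hU' hR
    ho hη hηB hδ hδ1 (by linarith) ((div_le_iff₀ (by positivity)).1 (by linarith)) (by linarith)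
    (by linarith) (by linarith) hn

theorem corollary2 (U U' R : ℝ) (hU : 0 < U) (hU' : 0 < U') (hR : 0 < R) :
    -- the constants depend on `U`, `U'`, `R` only
    ∃ (C : ℝ) (m : ℕ), 0 < C ∧
      ∀ (d : ℕ) (_ : 2 ≤ d) (p q : ℝ≥0∞) (_ : 2 ≤ p) (_ : p.HolderConjugate q)
        (r : ℝ) (_ : 0 ≤ r) (_ : r ≤ R)
        (D : Measure ((Fin d → ℝ) × ℝ)) (_ : IsProbabilityMeasure D)
        (_ : ∀ᵐ z ∂D, z.2 = 1 ∨ z.2 = -1)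
        (_ : ∀ᵐ z ∂D, vecNorm p z.1 ≤ 1)
        (_ : AntiConcentrated D.fst U) (_ : AntiAntiConcentrated D.fst U' R)
        (η : ℝ) (_ : 0 < η)
        (_ : η ≤ robustOpt D p q r / (4 * (if p ≤ 2 then 4 else 4 * (d : ℝ))))
        (δ : ℝ) (_ : 0 < δ) (_ : δ < 1)
        (n : ℕ)
        (_ : C * Real.log (d / (robustOpt D p q r * δ)) ^ m *
          ((d : ℝ) ^ (1 - 2 * p⁻¹.toReal) / robustOpt D p q r ^ 2) ≤ n),
        -- with probability at least `1 - δ` over the i.i.d. sample `S` of size `n`,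
        -- every run from `w 0 = 0` finds such a classifier
        Measure.pi (fun _ : Fin n => D)
          {S | ¬ ∀ w : ℕ → Fin d → ℝ, IsAdversarialTraining p r η S w → w 0 = 0 →
            ∃ k : ℕ,
              (k : ℝ) ≤ C * Real.log (d / robustOpt D p q r) ^ m *
                (η⁻¹ * (d : ℝ) ^ (3 / 2 * p⁻¹.toReal - 3 / 4) / robustOpt D p q r ^ 3) ∧
              robustError D p r (w k) ≤ C * Real.log (d / robustOpt D p q r) ^ m *
                ((d : ℝ) ^ (1 / 4 - 1 / 2 * p⁻¹.toReal) * √(robustOpt D p q r) +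
                  (d : ℝ) ^ (1 / 2 - p⁻¹.toReal) * robustOpt D p q r) ∧
              (p = 2 → robustError D p r (w k) ≤
                C * Real.log (d / robustOpt D p q r) ^ m * √(robustOpt D p q r)) ∧
              (p = ∞ → robustError D p r (w k) ≤
                C * Real.log (d / robustOpt D p q r) ^ m *
                  ((d : ℝ) ^ (1 / 4 : ℝ) * √(robustOpt D p q r) +
                    (d : ℝ) ^ (1 / 2 : ℝ) * robustOpt D p q r))} ≤
          ENNReal.ofReal δ := by
  obtain ⟨C, hC, h⟩ := corollary2_general U U' R hU hU' hR
  refine ⟨2 * C, 1, by positivity, ?_⟩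
  intro d hd p q hp hpq r hr _ D _ hy hx hA hAA η hη hηo δ hδ hδ1 n hn
  have hq : q ≠ 0 := ENNReal.HolderConjugate.ne_zero q p
  obtain ⟨ho, hstep, hsample⟩ :=
    admissible_of_le_div hd hp (by linarith) robustOpt_le_one hη hηo hδ hδ1.le hn
  exact (h d hd p q hp hq r hr D ‹_› hy hx hA hAA ho η hη hstep δ hδ hδ1.le n hsample).trans' <|
    measure_mono fun S hS hgood => hS fun w hw hw0 => (hgood w hw hw0).imp fun k hk =>
      rates_of_le_sqrt hd hC hη ho robustOpt_le_one hk.1 hk.2
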